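/- Let $A=K[x_1,\dots,x_m]$ be a standard graded polynomial ring over an infinite field $K$. For a nonzero finitely generated graded $A$-module $M$ with graded Betti numbers $\beta_{i,j}(M)$ (the number of copies of $A(-j)$ in homological degree $i$ of the minimal graded free resolution of $M$), let $\operatorname{reg}(M)=\sup\{\,j-i : \beta_{i,j}(M)\neq 0\,\}$ be its Castelnuovo–Mumford regularity. Let $I=\langle f_1,\dots,f_n\rangle$, $n\ge 1$, where $f_1,\dots,f_n\in A$ are homogeneous of degrees $d_1,\dots,d_n$, and assume: 1. $I$ is an almost complete intersection, that is, the minimal number of generators of $I$ is $\operatorname{ht}(I)+1$, and for every minimal prime $\mathfrak p$ of $I$ the ideal $I_{\mathfrak p}$ of $A_{\mathfrak p}$ is a complete intersection (generated by a regular sequence); 2. $f_1,\dots,f_n$ is a $d$-sequence, that is, $(\langle f_1,\dots,f_{i-1}\rangle : f_i)\cap I=\langle f_1,\dots,f_{i-1}\rangle$ for $i=1,\dots,n$; 3. $f_1,\dots,f_{n-1}$ is a regular sequence in $A$; 4. $\operatorname{reg}(A/I)<\sum_{l=1}^{n-1}d_l-n+1$; 5. $d_n=\max\{d_1,\dots,d_n\}$.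 Then for all integers $s\ge 2$ and $0\le i\le n-1$, $$\operatorname{reg}\left(\frac{A}{\langle f_1,\dots,f_i\rangle+I^s}\right)=\sum_{l=1}^{n}d_l-n+(s-2)d_n .$$ -/

import Mathlib

/-- The ideal `⟨f_1, …, f_i⟩` generated by the first `i` terms of a finite sequence. -/
def initialIdeal {R : Type*} [CommRing R] {n : ℕ} (f : Fin n → R) (i : ℕ) : Ideal R :=
  Ideal.span (f '' {j : Fin n | (j : ℕ) < i})

/-- `f_1, …, f_n` is a `d`-sequence: `(⟨f_1, …, f_{i-1}⟩ : f_i) ∩ ⟨f_1, …, f_n⟩ = ⟨f_1, …, f_{i-1}⟩`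
for `i = 1, …, n` (the terms are indexed from `0` here, so the term at position `i : Fin n` is
preceded by exactly `i` terms). -/
def IsDSequence {R : Type*} [CommRing R] {n : ℕ} (f : Fin n → R) : Prop :=
  ∀ i : Fin n, (initialIdeal f i).colon {f i} ⊓ Ideal.span (Set.range f) = initialIdeal f i

/-- An ideal is a complete intersection if it is generated by a regular sequence. -/
def IsCompleteIntersectionIdeal {R : Type*} [CommRing R] (I : Ideal R) : Prop :=
  ∃ rs : List R, RingTheory.Sequence.IsRegular R rs ∧ Ideal.ofList rs = I

/-- An ideal `I` of a Noetherian ring is an almost complete intersection if its minimal number of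
generators is `ht I + 1` and `I_p` is a complete intersection for every minimal prime `p` of `I`. -/
def IsAlmostCompleteIntersection {R : Type*} [CommRing R] (I : Ideal R) : Prop :=
  ((Submodule.spanFinrank I : ℕ) : ℕ∞) = I.height + 1 ∧
    ∀ (p : Ideal R) [p.IsPrime], p ∈ I.minimalPrimes →
      IsCompleteIntersectionIdeal (I.map (algebraMap R (Localization.AtPrime p)))

/-- The degree `j` piece of the standard graded polynomial ring, `j : ℤ` (zero if `j < 0`). -/
noncomputable def polyPiece (K : Type*) [Field K] (σ : Type*) (j : ℤ) :
    Submodule K (MvPolynomial σ K) :=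
  MvPolynomial.weightedHomogeneousSubmodule K (fun _ : σ => (1 : ℤ)) j

/-- The grading which `A/𝔞` inherits from the polynomial ring `A` (for a homogeneous ideal `𝔞`). -/
noncomputable def quotientPiece {K : Type*} [Field K] {σ : Type*}
    (𝔞 : Ideal (MvPolynomial σ K)) (j : ℤ) : Submodule K (MvPolynomial σ K ⧸ 𝔞) :=
  (polyPiece K σ j).map (Ideal.Quotient.mkₐ K 𝔞).toLinearMap

/-- A minimal graded free resolution
`⋯ → F_2 → F_1 → F_0 → M → 0`, with `F_i = ⨁_k A(-deg i k)` of finite rank,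
of a module `M` over the standard graded polynomial ring `A`, where `M` is graded with
pieces `ℳ j`, `j : ℤ`. -/
structure MinimalGradedFreeResolution {K : Type*} [Field K] {σ : Type*} {M : Type*}
    [AddCommGroup M] [Module (MvPolynomial σ K) M] [Module K M] (ℳ : ℤ → Submodule K M) where
  /-- the rank of `F_i` -/
  rank : ℕ → ℕ
  /-- the degrees of the basis elements of `F_i` -/
  deg : ∀ i : ℕ, Fin (rank i) → ℤ
  /-- the augmentation `F_0 → M` -/
  aug : (Fin (rank 0) → MvPolynomial σ K) →ₗ[MvPolynomial σ K] M
  /-- the differential `F_{i+1} → F_i` -/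
  diff : ∀ i : ℕ, (Fin (rank (i + 1)) → MvPolynomial σ K) →ₗ[MvPolynomial σ K]
    (Fin (rank i) → MvPolynomial σ K)
  /-- the augmentation is homogeneous of degree `0` -/
  aug_mem : ∀ k, aug (Pi.single k 1) ∈ ℳ (deg 0 k)
  /-- the differentials are homogeneous of degree `0` -/
  diff_mem : ∀ i k l, diff i (Pi.single k 1) l ∈ polyPiece K σ (deg (i + 1) k - deg i l)
  aug_surjective : Function.Surjective aug
  exact_zero : Function.Exact (diff 0) aug
  exact_succ : ∀ i, Function.Exact (diff (i + 1)) (diff i)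
  /-- minimality: the image of `F_{i+1}` lies in `𝔪 F_i`, `𝔪` the ideal of the variables -/
  minimal : ∀ i k l, MvPolynomial.constantCoeff (diff i (Pi.single k 1) l) = 0

/-- The graded Betti number `β_{i,j}` read off from a minimal graded free resolution: the number
of summands `A(-j)` of `F_i`. -/
def MinimalGradedFreeResolution.betti {K : Type*} [Field K] {σ : Type*} {M : Type*}
    [AddCommGroup M] [Module (MvPolynomial σ K) M] [Module K M] {ℳ : ℤ → Submodule K M}
    (F : MinimalGradedFreeResolution (σ := σ) ℳ) (i : ℕ) (j : ℤ) : ℕ :=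
  (Finset.univ.filter fun k => F.deg i k = j).card

/-- The Castelnuovo-Mumford regularity `sup {j - i : β_{i,j}(M) ≠ 0}` of a finitely generated graded
module `M = ⨁_j ℳ j` over the standard graded polynomial ring; the regularity of the zero module
is `-∞`. The minimal graded free resolution exists and is unique up to isomorphism, so all `F`
below have the same Betti numbers. -/
noncomputable def gradedRegularity {K : Type*} [Field K] {σ : Type*} {M : Type*}
    [AddCommGroup M] [Module (MvPolynomial σ K) M] [Module K M] (ℳ : ℤ → Submodule K M) : EReal :=
  sSup {x : EReal | ∃ (F : MinimalGradedFreeResolution (σ := σ) ℳ) (i : ℕ) (j : ℤ),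
    F.betti i j ≠ 0 ∧ x = (((j - (i : ℤ) : ℤ) : ℝ) : EReal)}

/-- The regularity of the graded module `A/𝔞`, `𝔞` a homogeneous ideal of the standard graded
polynomial ring `A`. -/
noncomputable def quotientRegularity {K : Type*} [Field K] {σ : Type*}
    (𝔞 : Ideal (MvPolynomial σ K)) : EReal :=
  gradedRegularity (σ := σ) (quotientPiece 𝔞)

/-! Write `J_i` for the ideal of the first `i` generators, `J = J_{n-1}`, `D = d_n` and `ρ = ∑_{l<n}
(d_l - 1)`. The number `ρ` is the regularity of `A/J`, since `J` is generated by a regular sequence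
(`hasReg_initialIdeal`), and the numerical hypothesis says `reg (A/I) ≤ ρ - 1`. Three families of
exact sequences `0 → (A/(𝔟 : g))(-deg g) → A/𝔟 → A/(𝔟 + (g)) → 0` then determine everything.

With `𝔟 = J`, `g = f_n`, the right term `A/I` is too small to matter, so `reg A/(J : f_n) = ρ - D`.
With `𝔟 = J`, `g = f_n^s`, the `d`-sequence property gives `J : f_n^s = J : f_n`
(`IsDSequence.mem_colon_pow`), while `J + I^s = J + (f_n^s)`. For `s ≥ 2` the left term has
regularity `ρ + (s-1)D > ρ`, so `reg A/(J + I^s) = ρ + (s-1)D - 1`, which is the claimed value.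
Finally, for `i < n - 1`, one has `(J_i + I^{s+1}) : f_{i+1} = J_i + I^s`
(`IsDSequence.mem_sup_pow_iff`). Since `d_{i+1} ≤ D`, the left term never exceeds the right one, and
the value descends from `J_{i+1} + I^{s+1}` to `J_i + I^{s+1}`.

Regularity is handled through bounds `RegLE`, witnessed by free resolutions that need not be
minimal; the horseshoe lemma and a pullback give the usual inequalities along short exact sequences.
The theorem `regLE_iff_deg_le` identifies these bounds with those read off from any minimal
resolution. -/

open MvPolynomial

universe u

/-! ### Homogeneous components of polynomials, in integer degrees. -/

section PolyComp

variable {K : Type*} [Field K] {σ : Type*}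

/-- The homogeneous component of degree `j : ℤ` of a polynomial. -/
noncomputable def polyComp (j : ℤ) : MvPolynomial σ K →ₗ[K] MvPolynomial σ K :=
  weightedHomogeneousComponent (fun _ : σ => (1 : ℤ)) j

lemma polyComp_mem (j : ℤ) (a : MvPolynomial σ K) : polyComp j a ∈ polyPiece K σ j :=
  weightedHomogeneousComponent_mem _ _ _

lemma polyComp_of_mem {d : ℤ} {a : MvPolynomial σ K} (ha : a ∈ polyPiece K σ d) (j : ℤ) :
    polyComp j a = if j = d then a else 0 :=
  weightedHomogeneousComponent_of_mem ha

lemma mem_polyPiece_iff {j : ℤ} {a : MvPolynomial σ K} :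
    a ∈ polyPiece K σ j ↔ polyComp j a = a :=
  ⟨fun h => by simp [polyComp_of_mem h], fun h => h ▸ polyComp_mem j a⟩

lemma polyComp_self (j : ℤ) (a : MvPolynomial σ K) : polyComp j (polyComp j a) = polyComp j a :=
  mem_polyPiece_iff.1 (polyComp_mem j a)

lemma polyComp_one (j : ℤ) : polyComp j (1 : MvPolynomial σ K) = if j = 0 then 1 else 0 :=
  polyComp_of_mem (isWeightedHomogeneous_one K _) j

lemma polyComp_exists_sum (a : MvPolynomial σ K) :
    ∃ s : Finset ℤ, (∀ j ∉ s, polyComp j a = 0) ∧ ∑ j ∈ s, polyComp j a = a := by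
  have hfin := weightedHomogeneousComponent_finsupp (w := fun _ : σ => (1 : ℤ)) a
  refine ⟨hfin.toFinset, fun j hj => by
    by_contra h
    exact hj (hfin.mem_toFinset.2 h), ?_⟩
  have := finsum_weightedHomogeneousComponent (w := fun _ : σ => (1 : ℤ)) a
  rwa [finsum_eq_sum _ hfin] at this

lemma mul_mem_polyPiece {d e : ℤ} {a b : MvPolynomial σ K} (ha : a ∈ polyPiece K σ d)
    (hb : b ∈ polyPiece K σ e) : a * b ∈ polyPiece K σ (d + e) :=
  IsWeightedHomogeneous.mul ha hb

lemma polyComp_mul_of_mem {d : ℤ} {b : MvPolynomial σ K} (hb : b ∈ polyPiece K σ d) (j : ℤ)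
    (a : MvPolynomial σ K) : polyComp j (a * b) = polyComp (j - d) a * b := by
  obtain ⟨s, hs0, hs⟩ := polyComp_exists_sum a
  conv_lhs => rw [← hs, Finset.sum_mul, map_sum]
  have : ∀ i ∈ s, polyComp j (polyComp i a * b) = if j - d = i then polyComp i a * b else 0 := by
    intro i _
    rw [polyComp_of_mem (mul_mem_polyPiece (polyComp_mem i a) hb)]
    simp only [sub_eq_iff_eq_add]
  rw [Finset.sum_congr rfl this, Finset.sum_ite_eq]
  split_ifs with h
  · rfl
  · rw [hs0 _ h, zero_mul]

lemma IsHomogeneous.mem_polyPiece {a : MvPolynomial σ K} {d : ℕ} (h : a.IsHomogeneous d) :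
    a ∈ polyPiece K σ (d : ℤ) := by
  intro c hc
  have := h hc
  simp only [Finsupp.weight_apply, Finsupp.sum, smul_eq_mul, mul_one, Pi.one_apply] at this ⊢
  rw [← this]
  simp

lemma polyPiece_eq_zero_of_neg {a : MvPolynomial σ K} {d : ℤ} (h : a ∈ polyPiece K σ d)
    (hd : d < 0) : a = 0 := by
  ext c
  by_contra hc
  have := h (d := c) (by simpa using hc)
  simp only [Finsupp.weight_apply, Finsupp.sum] at this
  have h2 : (0 : ℤ) ≤ ∑ x ∈ c.support, c x • 1 := Finset.sum_nonneg fun i _ => by simp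
  omega

lemma constantCoeff_eq_zero_of_mem {a : MvPolynomial σ K} {d : ℤ} (h : a ∈ polyPiece K σ d)
    (hd : d ≠ 0) : constantCoeff a = 0 := by
  by_contra hc
  have := h (d := 0) (by simpa [constantCoeff_eq] using hc)
  simp at this
  exact hd this.symm

lemma eq_C_of_mem_polyPiece_zero {a : MvPolynomial σ K} (h : a ∈ polyPiece K σ 0) :
    a = C (constantCoeff a) := by
  classical
  ext c
  rw [coeff_C]
  split_ifs with hc
  · rw [← hc]; rfl
  · by_contra hne
    have := h (d := c) hne
    simp only [Finsupp.weight_apply, Finsupp.sum] at this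
    rw [Finset.sum_eq_zero_iff_of_nonneg fun i _ => by simp] at this
    apply hc
    ext i
    by_contra hi
    have := this i (by simpa using fun h => hi (by simp [h]))
    simp at this
    exact hi (by simp [this])

lemma constantCoeff_polyComp_zero (a : MvPolynomial σ K) :
    constantCoeff (polyComp 0 a) = constantCoeff a := by
  classical
  simp [polyComp, constantCoeff_eq, coeff_weightedHomogeneousComponent]

end PolyComp

/-! ### Graded modules, graded maps and lifting. -/

/-- A graded module over the standard graded polynomial ring, the grading being given by the
projections onto the graded pieces. -/
structure GradedMod (K : Type u) [Field K] (σ : Type) where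
  carrier : Type u
  [addCommGroup : AddCommGroup carrier]
  [module : Module (MvPolynomial σ K) carrier]
  /-- the projection onto the piece of degree `j` -/
  proj : ℤ → carrier →+ carrier
  proj_self : ∀ j x, proj j (proj j x) = proj j x
  proj_smul : ∀ (a : MvPolynomial σ K) (x : carrier) (d j : ℤ), proj d x = x →
    proj j (a • x) = polyComp (j - d) a • x
  exists_sum : ∀ x, ∃ s : Finset ℤ, (∀ j ∉ s, proj j x = 0) ∧ ∑ j ∈ s, proj j x = x

namespace GradedMod

variable {K : Type u} [Field K] {σ : Type}

instance : CoeSort (GradedMod K σ) (Type u) := ⟨carrier⟩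
attribute [instance] addCommGroup module

/-- Homogeneous linear maps of degree `0`. -/
def IsGr (M N : GradedMod K σ) (f : M →ₗ[MvPolynomial σ K] N) : Prop :=
  ∀ j x, f (M.proj j x) = N.proj j (f x)

lemma exists_sum_superset (M : GradedMod K σ) (x : M) :
    ∃ s : Finset ℤ, ∀ t, s ⊆ t → (∀ j ∉ t, M.proj j x = 0) ∧ ∑ j ∈ t, M.proj j x = x := by
  obtain ⟨s, h0, hs⟩ := M.exists_sum x
  refine ⟨s, fun t ht => ⟨fun j hj => h0 j fun h => hj (ht h), ?_⟩⟩
  rw [← Finset.sum_subset ht fun j _ hj => h0 j hj, hs]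

/-- The graded module structure on a submodule which is stable under the projections. -/
@[reducible]
noncomputable def sub (M : GradedMod K σ) (N : Submodule (MvPolynomial σ K) M)
    (h : ∀ j, ∀ x ∈ N, M.proj j x ∈ N) : GradedMod K σ where
  carrier := N
  proj j := ((M.proj j).comp N.toAddSubgroup.subtype).codRestrict N.toAddSubgroup
    fun x => h j x x.2
  proj_self j x := Subtype.ext (M.proj_self j x)
  proj_smul a x d j hx := Subtype.ext (M.proj_smul a x d j (congrArg Subtype.val hx))
  exists_sum x := by
    obtain ⟨s, h0, hs⟩ := M.exists_sum x
    refine ⟨s, fun j hj => Subtype.ext (h0 j hj), Subtype.ext ?_⟩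
    erw [AddSubmonoidClass.coe_finsetSum]
    exact hs

/-- The kernel of a homogeneous linear map. -/
@[reducible]
noncomputable def ker {M N : GradedMod K σ} (f : M →ₗ[MvPolynomial σ K] N) (hf : IsGr M N f) : GradedMod K σ :=
  M.sub (LinearMap.ker f) fun j x hx => by
    rw [LinearMap.mem_ker] at hx ⊢; rw [hf, hx, map_zero]

/-- The product of two graded modules. -/
@[reducible]
noncomputable def prod (M N : GradedMod K σ) : GradedMod K σ where
  carrier := M × N
  proj j := (M.proj j).prodMap (N.proj j)
  proj_self j x := Prod.ext (M.proj_self j x.1) (N.proj_self j x.2)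
  proj_smul a x d j hx := Prod.ext (M.proj_smul a x.1 d j (congrArg Prod.fst hx))
    (N.proj_smul a x.2 d j (congrArg Prod.snd hx))
  exists_sum x := by
    obtain ⟨s, hs⟩ := M.exists_sum_superset x.1
    obtain ⟨t, ht⟩ := N.exists_sum_superset x.2
    have h1 := hs (s ∪ t) Finset.subset_union_left
    have h2 := ht (s ∪ t) Finset.subset_union_right
    refine ⟨s ∪ t, fun j hj => Prod.ext (h1.1 j hj) (h2.1 j hj), Prod.ext ?_ ?_⟩
    · rw [Prod.fst_sum]; exact h1.2
    · rw [Prod.snd_sum]; exact h2.2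

/-- The shift `M(-d)`. -/
@[reducible]
noncomputable def shift (M : GradedMod K σ) (d : ℤ) : GradedMod K σ where
  carrier := M
  proj j := M.proj (j - d)
  proj_self j x := M.proj_self _ x
  proj_smul a x e j hx := by
    rw [M.proj_smul a x _ _ hx, sub_sub_sub_cancel_right]
  exists_sum x := by
    obtain ⟨s, h0, hs⟩ := M.exists_sum x
    refine ⟨s.map (addRightEmbedding d), fun j hj => h0 _ fun h => hj ?_, ?_⟩
    · exact Finset.mem_map.2 ⟨_, h, by simp⟩
    · simpa using hs

/-- The graded free module `⨁ A(-deg i)`. -/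
@[reducible]
noncomputable def free {ι : Type} [Fintype ι] (deg : ι → ℤ) : GradedMod K σ where
  carrier := ι → MvPolynomial σ K
  proj j := AddMonoidHom.pi fun i =>
    (polyComp (j - deg i)).toAddMonoidHom.comp (Pi.evalAddMonoidHom _ i)
  proj_self j x := funext fun i => polyComp_self _ _
  proj_smul a x d j hx := funext fun i => by
    have h : polyComp (d - deg i) (x i) = x i := congrFun hx i
    have h2 := polyComp_mul_of_mem (mem_polyPiece_iff.2 h) (j - deg i) a
    rw [sub_sub_sub_cancel_right] at h2
    exact h2
  exists_sum x := by
    classical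
    choose s h0 hs using fun i => polyComp_exists_sum (x i)
    let t : ι → Finset ℤ := fun i => (s i).map (addRightEmbedding (deg i))
    refine ⟨Finset.univ.biUnion t, fun j hj => funext fun i => h0 i _ fun h => hj ?_,
      funext fun i => ?_⟩
    · exact Finset.mem_biUnion.2 ⟨i, Finset.mem_univ _, Finset.mem_map.2 ⟨_, h, by simp⟩⟩
    · rw [Finset.sum_apply]
      refine (Finset.sum_subset (Finset.subset_biUnion_of_mem t (Finset.mem_univ i))
        fun j _ hj => h0 i _ fun h => hj ?_).symm.trans ?_
      · exact Finset.mem_map.2 ⟨_, h, by simp⟩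
      · rw [Finset.sum_map]
        refine Eq.trans (Finset.sum_congr rfl fun j _ => ?_) (hs i)
        show polyComp (addRightEmbedding (deg i) j - deg i) (x i) = _
        simp

@[simp] lemma free_proj_apply {ι : Type} [Fintype ι] (deg : ι → ℤ) (j : ℤ)
    (v : ι → MvPolynomial σ K) (i : ι) :
    (free deg : GradedMod K σ).proj j v i = polyComp (j - deg i) (v i) := rfl

lemma free_proj_single {ι : Type} [Fintype ι] [DecidableEq ι] (deg : ι → ℤ) (i : ι) :
    (free deg : GradedMod K σ).proj (deg i) (Pi.single i 1 : ι → MvPolynomial σ K) =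
      (Pi.single i 1 : ι → MvPolynomial σ K) := by
  funext l
  rw [free_proj_apply]
  rcases eq_or_ne l i with rfl | h
  · simp [polyComp_one]
  · simp [Pi.single_eq_of_ne h]

lemma isGr_linearCombination {ι : Type} [Fintype ι] (deg : ι → ℤ) (M : GradedMod K σ) (y : ι → M)
    (hy : ∀ i, M.proj (deg i) (y i) = y i) :
    IsGr (free deg) M (Fintype.linearCombination (MvPolynomial σ K) y) := by
  intro j v
  erw [Fintype.linearCombination_apply, Fintype.linearCombination_apply, map_sum]
  exact Finset.sum_congr rfl fun i _ => (M.proj_smul _ _ _ _ (hy i)).symm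

lemma eq_linearCombination {ι : Type} [Fintype ι] [DecidableEq ι] {M : GradedMod K σ}
    (φ : (ι → MvPolynomial σ K) →ₗ[MvPolynomial σ K] M) :
    φ = Fintype.linearCombination (MvPolynomial σ K) fun i => φ (Pi.single i 1) := by
  refine LinearMap.pi_ext' fun i => LinearMap.ext_ring ?_
  simp

lemma isGr_free_iff {ι : Type} [Fintype ι] [DecidableEq ι] (deg : ι → ℤ) (M : GradedMod K σ)
    (φ : (ι → MvPolynomial σ K) →ₗ[MvPolynomial σ K] M) :
    IsGr (free deg) M φ ↔
      ∀ i, M.proj (deg i) (φ (Pi.single i 1)) = φ (Pi.single i 1) := by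
  constructor
  · intro h i
    exact (h _ _).symm.trans (congrArg φ (free_proj_single deg i))
  · intro h
    have := isGr_linearCombination deg M _ h
    rwa [← eq_linearCombination] at this

/-- Graded projectivity: arbitrary preimages of the images of the basis vectors are replaced by
their components in the right degrees. -/
lemma exists_lift_of_surjective {ι : Type} [Fintype ι] (deg : ι → ℤ) {M P : GradedMod K σ}
    {g : M →ₗ[MvPolynomial σ K] P} (hg : IsGr M P g) (hs : Function.Surjective g)
    {φ : (ι → MvPolynomial σ K) →ₗ[MvPolynomial σ K] P} (hφ : IsGr (free deg) P φ) :
    ∃ ψ : (ι → MvPolynomial σ K) →ₗ[MvPolynomial σ K] M,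
      IsGr (free deg) M ψ ∧ ∀ v, g (ψ v) = φ v := by
  classical
  choose y hy using fun i => hs (φ (Pi.single i 1))
  refine ⟨Fintype.linearCombination (MvPolynomial σ K) fun i => M.proj (deg i) (y i),
    isGr_linearCombination _ _ _ fun i => M.proj_self _ _, fun v => ?_⟩
  conv_rhs => rw [eq_linearCombination φ]
  simp only [Fintype.linearCombination_apply, map_sum, map_smul, hg _ _, hy,
    (isGr_free_iff deg P φ).1 hφ]

lemma exists_lift_of_injective {X M N : GradedMod K σ} {f : N →ₗ[MvPolynomial σ K] M}
    (hf : IsGr N M f) (hi : Function.Injective f) {h : X →ₗ[MvPolynomial σ K] M} (hh : IsGr X M h)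
    (hr : ∀ x, ∃ y, f y = h x) :
    ∃ h' : X →ₗ[MvPolynomial σ K] N, IsGr X N h' ∧ ∀ x, f (h' x) = h x := by
  let h' : X →ₗ[MvPolynomial σ K] N :=
    (LinearEquiv.ofInjective f hi).symm.toLinearMap.comp (h.codRestrict (LinearMap.range f) hr)
  have key : ∀ x, f (h' x) = h x := fun x => by
    have := LinearEquiv.apply_symm_apply (LinearEquiv.ofInjective f hi)
      (h.codRestrict (LinearMap.range f) hr x)
    exact congrArg Subtype.val this
  exact ⟨h', fun j x => hi (by rw [key, hh, hf, key]), key⟩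

end GradedMod

/-! ### Regularity bounds and short exact sequences. -/

namespace GradedMod

variable {K : Type u} [Field K] {σ : Type}

/-- `M` has a graded free resolution whose first `k` terms are generated in degrees
`≤ c, c + 1, …, c + k - 1`. -/
def RegAt : ℕ → GradedMod K σ → ℤ → Prop
  | 0, _, _ => True
  | k + 1, M, c => ∃ (ι : Type) (_ : Fintype ι) (deg : ι → ℤ)
      (φ : (ι → MvPolynomial σ K) →ₗ[MvPolynomial σ K] M) (hφ : IsGr (free deg) M φ),
      (∀ i, deg i ≤ c) ∧ Function.Surjective φ ∧
        RegAt k (ker (M := free deg) φ hφ) (c + 1)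

lemma RegAt.mono {k : ℕ} {M : GradedMod K σ} {c c' : ℤ} (h : RegAt k M c) (hc : c ≤ c') :
    RegAt k M c' := by
  induction k generalizing M c c' with
  | zero => trivial
  | succ k ih =>
    obtain ⟨ι, _, deg, φ, hφ, hdeg, hs, hk⟩ := h
    exact ⟨ι, _, deg, φ, hφ, fun i => (hdeg i).trans hc, hs, ih hk (by omega)⟩

lemma RegAt.of_subsingleton {M : GradedMod K σ} (h : Subsingleton M) (k : ℕ) (c : ℤ) :
    RegAt k M c := by
  induction k generalizing M c with
  | zero => trivial
  | succ k ih =>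
    refine ⟨Empty, inferInstance, Empty.elim, 0, ?_, fun i => i.elim, fun x => ⟨0, h.elim _ _⟩,
      ih ?_ _⟩
    · intro j x; exact h.elim _ _
    · exact inferInstanceAs (Subsingleton (LinearMap.ker
        (0 : (Empty → MvPolynomial σ K) →ₗ[MvPolynomial σ K] M)))

/-- Horseshoe lemma. -/
lemma RegAt.extension {k : ℕ} {N M P : GradedMod K σ} {c : ℤ}
    {f : N →ₗ[MvPolynomial σ K] M} {g : M →ₗ[MvPolynomial σ K] P}
    (hf : IsGr N M f) (hg : IsGr M P g) (hi : Function.Injective f) (hs : Function.Surjective g)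
    (he : Function.Exact f g) (hN : RegAt k N c) (hP : RegAt k P c) : RegAt k M c := by
  induction k generalizing N M P c with
  | zero => trivial
  | succ k ih =>
    obtain ⟨ι, _, deg, φ, hφ, hdeg, hφs, hk⟩ := hN
    obtain ⟨ι', _, deg', φ', hφ', hdeg', hφs', hk'⟩ := hP
    obtain ⟨ψ, hψ, hψg⟩ := exists_lift_of_surjective deg' hg hs hφ'
    let L : (ι ⊕ ι' → MvPolynomial σ K) →ₗ[MvPolynomial σ K] (ι → MvPolynomial σ K) :=
      LinearMap.funLeft _ _ Sum.inl
    let R : (ι ⊕ ι' → MvPolynomial σ K) →ₗ[MvPolynomial σ K] (ι' → MvPolynomial σ K) :=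
      LinearMap.funLeft _ _ Sum.inr
    let Φ : (ι ⊕ ι' → MvPolynomial σ K) →ₗ[MvPolynomial σ K] M := f ∘ₗ φ ∘ₗ L + ψ ∘ₗ R
    have hΦ_apply : ∀ v, Φ v = f (φ (L v)) + ψ (R v) := fun v => rfl
    have hgΦ : ∀ v, g (Φ v) = φ' (R v) := fun v => by
      rw [hΦ_apply, map_add, he.apply_apply_eq_zero, zero_add, hψg]
    have hΦ : IsGr (free (Sum.elim deg deg')) M Φ := by
      intro j v
      rw [hΦ_apply, hΦ_apply, map_add, ← hf, ← hφ, ← hψ]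
      rfl
    refine ⟨ι ⊕ ι', inferInstance, Sum.elim deg deg', Φ, hΦ, ?_, ?_, ?_⟩
    · rintro (i | i)
      exacts [hdeg i, hdeg' i]
    · intro x
      obtain ⟨v', hv'⟩ := hφs' (g x)
      obtain ⟨y, hy⟩ := (he (x - ψ v')).1 (by rw [map_sub, hψg, hv', sub_self])
      obtain ⟨v, rfl⟩ := hφs y
      refine ⟨Sum.elim v v', ?_⟩
      rw [hΦ_apply]
      exact eq_sub_iff_add_eq.1 hy
    · let E : (ι → MvPolynomial σ K) →ₗ[MvPolynomial σ K] (ι ⊕ ι' → MvPolynomial σ K) :=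
        LinearMap.pi (Sum.elim (fun i => LinearMap.proj i) 0)
      have hLE : ∀ v, L (E v) = v := fun v => rfl
      have hRE : ∀ v, R (E v) = 0 := fun v => rfl
      have hE : ∀ v, R v = 0 → E (L v) = v := fun v hv => by
        funext i
        rcases i with i | i
        · rfl
        · exact (congrFun hv i).symm
      let a : LinearMap.ker φ →ₗ[MvPolynomial σ K] LinearMap.ker Φ :=
        E.restrict fun v hv => by
          rw [LinearMap.mem_ker] at hv ⊢
          rw [hΦ_apply, hLE, hRE, hv, map_zero, map_zero, add_zero]
      let b : LinearMap.ker Φ →ₗ[MvPolynomial σ K] LinearMap.ker φ' :=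
        R.restrict fun v hv => by
          rw [LinearMap.mem_ker] at hv ⊢
          rw [← hgΦ, hv, map_zero]
      -- The kernels of the three covers again form a short exact sequence, to which the induction
      -- hypothesis applies.
      refine ih (N := ker (M := free deg) φ hφ) (M := ker (M := free (Sum.elim deg deg')) Φ hΦ)
        (P := ker (M := free deg') φ' hφ') (f := a) (g := b) ?_ ?_ ?_ ?_ ?_ hk hk'
      · intro j v
        refine Subtype.ext (funext fun i => ?_)
        rcases i with i | i
        · rfl
        · exact (map_zero (polyComp (j - deg' i))).symm
      · intro j v; rfl
      · intro v w h
        exact Subtype.ext (congrArg (fun x : LinearMap.ker Φ => L x.1) h)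
      · rintro ⟨v, hv⟩
        obtain ⟨y, hy⟩ := (he (ψ v)).1 (by rw [hψg]; exact hv)
        obtain ⟨w, rfl⟩ := hφs y
        refine ⟨⟨Sum.elim (-w) v, ?_⟩, rfl⟩
        rw [LinearMap.mem_ker, hΦ_apply]
        show f (φ (-w)) + ψ v = 0
        rw [map_neg, map_neg, hy, neg_add_cancel]
      · rintro ⟨v, hv⟩
        constructor
        · intro h
          have hR : R v = 0 := congrArg Subtype.val h
          refine ⟨⟨L v, ?_⟩, Subtype.ext (hE v hR)⟩
          rw [LinearMap.mem_ker, hΦ_apply, hR, map_zero, add_zero] at hv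
          exact hi (hv.trans (map_zero f).symm)
        · rintro ⟨w, hw⟩
          rw [← hw]
          exact Subtype.ext (hRE w)

/-- An isomorphism is a short exact sequence with zero cokernel, so this is a case of the horseshoe
lemma. -/
lemma RegAt.of_equiv {k : ℕ} {M N : GradedMod K σ} {c : ℤ} (e : M ≃ₗ[MvPolynomial σ K] N)
    (he : IsGr M N e.toLinearMap) (h : RegAt k M c) : RegAt k N c := by
  let Z : GradedMod K σ := M.sub ⊥ fun j x hx => by
    rw [Submodule.mem_bot] at hx ⊢; rw [hx, map_zero]
  have hZ : Subsingleton Z := inferInstanceAs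
    (Subsingleton (⊥ : Submodule (MvPolynomial σ K) M))
  refine RegAt.extension (N := M) (P := Z) (f := e.toLinearMap) (g := 0) he ?_ e.injective
    (fun x => ⟨0, hZ.elim _ _⟩) (fun y => ?_) h (.of_subsingleton hZ k c)
  · intro j x; exact hZ.elim _ _
  · exact ⟨fun _ => ⟨e.symm y, e.apply_symm_apply y⟩, fun _ => rfl⟩

/-- A cover `F → M` composed with `M → P` covers `P`, and its kernel is an extension of `N` by the
kernel of `F → M`. -/
lemma RegAt.quotient {k : ℕ} {N M P : GradedMod K σ} {c : ℤ}
    {f : N →ₗ[MvPolynomial σ K] M} {g : M →ₗ[MvPolynomial σ K] P}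
    (hf : IsGr N M f) (hg : IsGr M P g) (hi : Function.Injective f) (hs : Function.Surjective g)
    (he : Function.Exact f g) (hM : RegAt (k + 1) M c) (hN : RegAt k N (c + 1)) :
    RegAt (k + 1) P c := by
  obtain ⟨ι, _, deg, φ, hφ, hdeg, hφs, hk⟩ := hM
  have hΦ : IsGr (free deg) P (g ∘ₗ φ) := fun j v => by
    rw [LinearMap.comp_apply, hφ, hg]; rfl
  refine ⟨ι, _, deg, g ∘ₗ φ, hΦ, hdeg, hs.comp hφs, ?_⟩
  let X : GradedMod K σ := ker (M := free deg) (g ∘ₗ φ) hΦ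
  obtain ⟨h', hgr, hh'⟩ := exists_lift_of_injective (X := X) hf hi
    (h := φ ∘ₗ (LinearMap.ker (g ∘ₗ φ)).subtype) (fun j x => hφ j x.1)
    (fun x => (he _).1 x.2)
  let a : LinearMap.ker φ →ₗ[MvPolynomial σ K] X :=
    Submodule.inclusion (LinearMap.ker_le_ker_comp φ g)
  refine RegAt.extension (N := ker (M := free deg) φ hφ) (M := X) (f := a) (g := h')
    (fun j x => rfl) hgr (Submodule.inclusion_injective _) ?_ ?_ hk hN
  · intro y
    obtain ⟨v, hv⟩ := hφs (f y)
    refine ⟨⟨v, ?_⟩, hi ?_⟩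
    · rw [LinearMap.mem_ker, LinearMap.comp_apply, hv, he.apply_apply_eq_zero]
    · rw [hh']; exact hv
  · intro x
    constructor
    · intro hx
      have := hh' x
      rw [hx, map_zero] at this
      exact ⟨⟨x.1, this.symm⟩, rfl⟩
    · rintro ⟨v, rfl⟩
      refine hi ?_
      rw [hh', map_zero]
      exact v.2

lemma regAt_free {ι : Type} [Fintype ι] (deg : ι → ℤ) {c : ℤ} (hdeg : ∀ i, deg i ≤ c) (k : ℕ) :
    RegAt k (free deg : GradedMod K σ) c := by
  cases k with
  | zero => trivial
  | succ k =>
    have hid : IsGr (GradedMod.free deg : GradedMod K σ) (GradedMod.free deg) LinearMap.id :=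
      fun j v => rfl
    refine ⟨ι, _, deg, LinearMap.id, hid, hdeg, Function.surjective_id,
      .of_subsingleton ?_ _ _⟩
    refine ⟨fun x y => Subtype.ext ?_⟩
    exact (LinearMap.mem_ker.1 x.2).trans (LinearMap.mem_ker.1 y.2).symm

/-- For a cover `F → P`, the pullback `E = M ×_P F` is an extension of `M` by the first syzygy of
`P`, which bounds `E`. As `F` is free, it lifts to `M`, and the graph of the lift is a copy of `F`
in `E` with quotient `N`; `RegAt.quotient` then bounds `N`. -/
lemma RegAt.kernel {k : ℕ} {N M P : GradedMod K σ} {c : ℤ}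
    {f : N →ₗ[MvPolynomial σ K] M} {g : M →ₗ[MvPolynomial σ K] P}
    (hf : IsGr N M f) (hg : IsGr M P g) (hi : Function.Injective f) (hs : Function.Surjective g)
    (he : Function.Exact f g) (hM : RegAt k M c) (hP : RegAt (k + 1) P (c - 1)) :
    RegAt k N c := by
  cases k with
  | zero => trivial
  | succ k =>
  obtain ⟨ι, _, deg, φ, hφ, hdeg, hφs, hk⟩ := hP
  rw [sub_add_cancel] at hk
  obtain ⟨ψ, hψ, hψg⟩ := exists_lift_of_surjective deg hg hs hφ
  let δ : M × (ι → MvPolynomial σ K) →ₗ[MvPolynomial σ K] P :=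
    g ∘ₗ LinearMap.fst _ _ _ - φ ∘ₗ LinearMap.snd _ _ _
  have hδ_apply : ∀ x, δ x = g x.1 - φ x.2 := fun x => rfl
  have hδ : IsGr (M.prod (GradedMod.free deg)) P δ := fun j x => by
    rw [hδ_apply, hδ_apply, map_sub, ← hg, ← hφ]; rfl
  let E : GradedMod K σ := ker (M := M.prod (GradedMod.free deg)) δ hδ
  have hmem : ∀ x : E, g x.1.1 = φ x.1.2 := fun x => sub_eq_zero.1 x.2
  have hE : RegAt (k + 1) E c := by
    let a : LinearMap.ker φ →ₗ[MvPolynomial σ K] E :=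
      (LinearMap.inr _ _ _).restrict fun v hv => by
        rw [LinearMap.mem_ker] at hv ⊢
        rw [hδ_apply]
        simp [hv]
    let b : E →ₗ[MvPolynomial σ K] M := LinearMap.fst _ _ _ ∘ₗ (LinearMap.ker δ).subtype
    refine RegAt.extension (N := ker (M := GradedMod.free deg) φ hφ) (M := E) (f := a) (g := b)
      ?_ (fun j x => rfl) ?_ ?_ ?_ hk hM
    · intro j v
      refine Subtype.ext (Prod.ext ?_ rfl)
      exact (map_zero (M.proj j)).symm
    · intro v w h
      exact Subtype.ext (congrArg (fun x : E => x.1.2) h)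
    · intro x
      obtain ⟨v, hv⟩ := hφs (g x)
      exact ⟨⟨(x, v), by rw [LinearMap.mem_ker, hδ_apply, hv, sub_self]⟩, rfl⟩
    · intro x
      constructor
      · intro hx
        have hx : x.1.1 = 0 := hx
        refine ⟨⟨x.1.2, ?_⟩, Subtype.ext (Prod.ext hx.symm rfl)⟩
        rw [LinearMap.mem_ker, ← hmem, hx, map_zero]
      · rintro ⟨v, rfl⟩
        rfl
  -- Subtracting the lift `ψ` moves `(x, v)` into the kernel of `g`, which is `N`; the pairs sent to
  -- `0` form the graph of `ψ`.
  let h : E →ₗ[MvPolynomial σ K] M :=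
    (LinearMap.fst _ _ _ - ψ ∘ₗ LinearMap.snd _ _ _) ∘ₗ (LinearMap.ker δ).subtype
  have hh_apply : ∀ x, h x = x.1.1 - ψ x.1.2 := fun x => rfl
  obtain ⟨h', hgr, hh'⟩ := exists_lift_of_injective (X := E) (h := h) hf hi
    (fun j x => by rw [hh_apply, hh_apply, map_sub, ← hψ]; rfl)
    (fun x => (he _).1 (by rw [hh_apply, map_sub, hψg, hmem, sub_self]))
  let a : (ι → MvPolynomial σ K) →ₗ[MvPolynomial σ K] E :=
    (ψ.prod LinearMap.id).codRestrict (LinearMap.ker δ) fun v => by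
      rw [LinearMap.mem_ker, hδ_apply]
      exact sub_eq_zero.2 (hψg v)
  refine RegAt.quotient (N := GradedMod.free deg) (M := E) (f := a) (g := h') ?_ hgr ?_ ?_ ?_ hE
    (regAt_free deg (fun i => (hdeg i).trans (by omega)) k)
  · intro j v
    exact Subtype.ext (Prod.ext (hψ j v) rfl)
  · intro v w hvw
    exact congrArg (fun x : E => x.1.2) hvw
  · intro y
    refine ⟨⟨(f y, 0), ?_⟩, hi ?_⟩
    · rw [LinearMap.mem_ker, hδ_apply, map_zero, sub_zero]
      exact he.apply_apply_eq_zero y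
    · rw [hh', hh_apply]
      show f y - ψ 0 = f y
      rw [map_zero, sub_zero]
  · intro x
    constructor
    · intro hx
      have := hh' x
      rw [hx, map_zero, hh_apply] at this
      exact ⟨x.1.2, Subtype.ext (Prod.ext (sub_eq_zero.1 this.symm).symm rfl)⟩
    · rintro ⟨v, rfl⟩
      refine hi ?_
      rw [hh', map_zero, hh_apply]
      exact sub_self _

lemma RegAt.shift {k : ℕ} {M : GradedMod K σ} {c : ℤ} (h : RegAt k M c) (d : ℤ) :
    RegAt k (M.shift d) (c + d) := by
  induction k generalizing M c with
  | zero => trivial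
  | succ k ih =>
    obtain ⟨ι, _, deg, φ, hφ, hdeg, hs, hk⟩ := h
    have key : ∀ j v, (GradedMod.free fun i => deg i + d : GradedMod K σ).proj j v =
        (GradedMod.free deg : GradedMod K σ).proj (j - d) v := fun j v => by
      funext i
      erw [free_proj_apply, free_proj_apply]
      congr 2; ring
    have hφ' : IsGr (GradedMod.free fun i => deg i + d) (M.shift d) φ := fun j v => by
      rw [key]; exact hφ _ v
    refine ⟨ι, _, fun i => deg i + d, φ, hφ', fun i => by linarith [hdeg i], hs, ?_⟩
    have := ih hk
    rw [show c + d + 1 = c + 1 + d by ring]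
    refine this.of_equiv (LinearEquiv.refl _ (LinearMap.ker φ)) ?_
    intro j v
    exact Subtype.ext (key j v.1).symm

/-- Castelnuovo-Mumford regularity at most `c`. -/
def RegLE (M : GradedMod K σ) (c : ℤ) : Prop := ∀ k, RegAt k M c

lemma RegLE.mono {M : GradedMod K σ} {c c' : ℤ} (h : RegLE M c) (hc : c ≤ c') : RegLE M c' :=
  fun k => (h k).mono hc

lemma RegLE.shift {M : GradedMod K σ} {c : ℤ} (h : RegLE M c) (d : ℤ) :
    RegLE (M.shift d) (c + d) := fun k => (h k).shift d

lemma regLE_shift_iff {M : GradedMod K σ} {c d : ℤ} : RegLE (M.shift d) c ↔ RegLE M (c - d) := by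
  constructor
  · intro h k
    refine RegAt.of_equiv (M := (M.shift d).shift (-d)) (LinearEquiv.refl _ M.carrier) ?_
      ((h k).shift (-d))
    intro j x
    show M.proj (j - -d - d) x = M.proj j x
    congr 2; ring
  · intro h
    simpa using h.shift d

section ShortExact

variable {N M P : GradedMod K σ} {c : ℤ}
    {f : N →ₗ[MvPolynomial σ K] M} {g : M →ₗ[MvPolynomial σ K] P}

variable (N M P f g) in
/-- Short exact sequences of graded modules. -/
structure IsShortExact : Prop where
  left : IsGr N M f
  right : IsGr M P g
  injective : Function.Injective f
  surjective : Function.Surjective g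
  exact : Function.Exact f g

lemma IsShortExact.regLE_middle (h : IsShortExact N M P f g) (hN : RegLE N c) (hP : RegLE P c) :
    RegLE M c := fun k =>
  RegAt.extension h.left h.right h.injective h.surjective h.exact (hN k) (hP k)

lemma IsShortExact.regLE_right (h : IsShortExact N M P f g) (hM : RegLE M c)
    (hN : RegLE N (c + 1)) : RegLE P c
  | 0 => trivial
  | k + 1 => RegAt.quotient h.left h.right h.injective h.surjective h.exact (hM (k + 1)) (hN k)

lemma IsShortExact.regLE_left (h : IsShortExact N M P f g) (hM : RegLE M c)
    (hP : RegLE P (c - 1)) : RegLE N c := fun k =>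
  RegAt.kernel h.left h.right h.injective h.surjective h.exact (hM k) (hP (k + 1))

end ShortExact

end GradedMod

/-! ### Minimal covers and minimal resolutions. -/

namespace GradedMod

variable {K : Type u} [Field K] {σ : Type}

/-- The short exact sequence of a graded surjection and its kernel. -/
lemma isShortExact_ker {M P : GradedMod K σ} {g : M →ₗ[MvPolynomial σ K] P} (hg : IsGr M P g)
    (hs : Function.Surjective g) :
    IsShortExact (ker g hg) M P (LinearMap.ker g).subtype g where
  left _ _ := rfl
  right := hg
  injective := Subtype.val_injective
  surjective := hs
  exact := LinearMap.exact_subtype_ker_map g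

/-- `RegAt` supplies some cover with good syzygies; here the cover is arbitrary, which allows a
bound to be propagated along a given resolution. -/
lemma RegLE.firstSyzygy {ι : Type} [Fintype ι] {deg : ι → ℤ} {M : GradedMod K σ} {c : ℤ}
    {φ : (ι → MvPolynomial σ K) →ₗ[MvPolynomial σ K] M} (hφ : IsGr (free deg) M φ)
    (hs : Function.Surjective φ) (hdeg : ∀ i, deg i ≤ c) (hM : RegLE M c) :
    RegLE (ker (M := free deg) φ hφ) (c + 1) := by
  refine IsShortExact.regLE_left (isShortExact_ker (M := free deg) hφ hs)
    (fun k => regAt_free deg (fun i => (hdeg i).trans (by omega)) k) ?_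
  rwa [add_sub_cancel_right]

/-- The degrees of a minimal system of generators are bounded by those of any other one. -/
lemma RegAt.deg_le {ι : Type} [Fintype ι] [DecidableEq ι] {deg : ι → ℤ} {M : GradedMod K σ} {c : ℤ}
    {k : ℕ} {φ : (ι → MvPolynomial σ K) →ₗ[MvPolynomial σ K] M} (hφ : IsGr (free deg) M φ)
    (hs : Function.Surjective φ) (hmin : ∀ v, φ v = 0 → ∀ i, constantCoeff (v i) = 0)
    (hM : RegAt (k + 1) M c) (i : ι) : deg i ≤ c := by
  classical
  obtain ⟨ι', _, deg', φ', hφ', hdeg', hs', -⟩ := hM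
  by_contra! hlt
  obtain ⟨a, ha⟩ := hs' (φ (Pi.single i 1))
  have ha' : φ' ((free deg' : GradedMod K σ).proj (deg i) a) = φ (Pi.single i 1) := by
    rw [hφ', ha, (isGr_free_iff deg M φ).1 hφ]
  choose w hw using fun l => hs (φ' (Pi.single l 1))
  set b : ι' → MvPolynomial σ K := (free deg' : GradedMod K σ).proj (deg i) a with hb
  -- If `deg i > c`, the coefficients expressing the `i`-th generator through generators of degree
  -- at most `c` have nonzero degree.
  have hbl : ∀ l, constantCoeff (b l) = 0 := fun l =>
    constantCoeff_eq_zero_of_mem (polyComp_mem (deg i - deg' l) (a l))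
      (by have := hdeg' l; omega)
  -- This relation has constant term `1` in coordinate `i`, contrary to minimality.
  have hker : φ (Pi.single i 1 - ∑ l, b l • w l) = 0 := by
    rw [map_sub, map_sum, ← ha']
    conv_lhs => enter [1]; rw [eq_linearCombination φ', Fintype.linearCombination_apply]
    simp [hw]
  have := hmin _ hker i
  simp [hbl] at this

variable (M : GradedMod K σ)

/-- A minimal graded free cover. -/
structure MinimalCover where
  rank : ℕ
  deg : Fin rank → ℤ
  map : (Fin rank → MvPolynomial σ K) →ₗ[MvPolynomial σ K] M
  isGr : IsGr (free deg) M map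
  surjective : Function.Surjective map
  minimal : ∀ v, map v = 0 → ∀ i, constantCoeff (v i) = 0

lemma exists_homogeneous_generators [Module.Finite (MvPolynomial σ K) M] :
    ∃ T : Finset M, (∀ y ∈ T, ∃ d, M.proj d y = y) ∧
      Submodule.span (MvPolynomial σ K) (T : Set M) = ⊤ := by
  classical
  obtain ⟨S, hS⟩ := Module.Finite.fg_top (R := MvPolynomial σ K) (M := M)
  choose s h0 hs using M.exists_sum
  refine ⟨S.biUnion fun x => (s x).image fun j => M.proj j x, ?_, ?_⟩
  · intro y hy
    simp only [Finset.mem_biUnion, Finset.mem_image] at hy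
    obtain ⟨x, -, j, -, rfl⟩ := hy
    exact ⟨j, M.proj_self j x⟩
  · rw [eq_top_iff, ← hS, Submodule.span_le]
    intro x hx
    rw [SetLike.mem_coe, ← hs x]
    refine Submodule.sum_mem _ fun j hj => Submodule.subset_span ?_
    simp only [Finset.coe_biUnion, Set.mem_iUnion, Finset.coe_image]
    exact ⟨x, hx, j, hj, rfl⟩

/-- Take a homogeneous generating set of least cardinality: a relation with a nonzero constant
coefficient would make one generator redundant. -/
lemma nonempty_minimalCover [Module.Finite (MvPolynomial σ K) M] : Nonempty (MinimalCover M) := by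
  classical
  let p : ℕ → Prop := fun r => ∃ T : Finset M, T.card = r ∧ (∀ y ∈ T, ∃ d, M.proj d y = y) ∧
      Submodule.span (MvPolynomial σ K) (T : Set M) = ⊤
  have hp : ∃ r, p r := by
    obtain ⟨T, hT⟩ := M.exists_homogeneous_generators
    exact ⟨_, T, rfl, hT⟩
  obtain ⟨T, hcard, hT, hspan⟩ := Nat.find_spec hp
  let y : Fin T.card → M := fun i => (T.equivFin.symm i : T).1
  have hyT : ∀ i, y i ∈ T := fun i => (T.equivFin.symm i).2
  have hyinj : Function.Injective y := Subtype.val_injective.comp T.equivFin.symm.injective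
  choose deg hdeg using fun i => hT (y i) (hyT i)
  have hgr := isGr_linearCombination deg M y hdeg
  refine ⟨⟨T.card, deg, Fintype.linearCombination _ y, hgr, ?_, ?_⟩⟩
  · rw [← LinearMap.range_eq_top, Fintype.range_linearCombination, eq_top_iff, ← hspan]
    refine Submodule.span_mono fun x hx => ⟨T.equivFin ⟨x, hx⟩, ?_⟩
    simp [y]
  · intro v hv i
    by_contra hne
    -- Passing to the component of degree `deg i` turns the `i`-th coefficient of the relation into
    -- a nonzero scalar, which can be inverted.
    have hw : Fintype.linearCombination (MvPolynomial σ K) y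
        ((free deg : GradedMod K σ).proj (deg i) v) = 0 := by
      rw [hgr, hv, map_zero]
    rw [Fintype.linearCombination_apply, ← Finset.add_sum_erase _ _ (Finset.mem_univ i)] at hw
    have hwi : polyComp (deg i - deg i) (v i) = C (constantCoeff (v i)) := by
      rw [sub_self, eq_C_of_mem_polyPiece_zero (polyComp_mem 0 (v i)), constantCoeff_polyComp_zero]
    rw [free_proj_apply, hwi] at hw
    have hmem : y i ∈ Submodule.span (MvPolynomial σ K) (T.erase (y i) : Set M) := by
      have h1 : (C (constantCoeff (v i)) : MvPolynomial σ K) • y i ∈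
          Submodule.span (MvPolynomial σ K) (T.erase (y i) : Set M) := by
        rw [eq_neg_of_add_eq_zero_left hw]
        refine Submodule.neg_mem _ (Submodule.sum_mem _ fun l hl => Submodule.smul_mem _ _
          (Submodule.subset_span ?_))
        rw [Finset.mem_coe, Finset.mem_erase]
        exact ⟨fun h => (Finset.mem_erase.1 hl).1 (hyinj h), hyT l⟩
      have h2 := Submodule.smul_mem _ (C (constantCoeff (v i))⁻¹) h1
      rwa [smul_smul, ← C_mul, inv_mul_cancel₀ hne, C_1, one_smul] at h2
    refine Nat.find_min hp (m := (T.erase (y i)).card) ?_ ⟨T.erase (y i), rfl,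
      fun z hz => hT z (Finset.mem_of_mem_erase hz), ?_⟩
    · rw [← hcard]
      exact Finset.card_erase_lt_of_mem (hyT i)
    · rw [eq_top_iff, ← hspan, Submodule.span_le]
      intro z hz
      rcases eq_or_ne z (y i) with rfl | h
      · exact hmem
      · exact Submodule.subset_span (Finset.mem_coe.2 (Finset.mem_erase.2 ⟨h, hz⟩))

section Resolution

variable [Finite σ]

/-- A chosen minimal graded free cover. -/
noncomputable def minimalCover (N : {M : GradedMod K σ // Module.Finite (MvPolynomial σ K) M}) :
    MinimalCover N.1 :=
  haveI := N.2
  (nonempty_minimalCover N.1).some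

/-- The syzygy modules of the chosen minimal covers. -/
noncomputable def syzygy [Module.Finite (MvPolynomial σ K) M] :
    ℕ → {M : GradedMod K σ // Module.Finite (MvPolynomial σ K) M}
  | 0 => ⟨M, inferInstance⟩
  | i + 1 => ⟨ker (M := free (minimalCover (syzygy i)).deg) (minimalCover (syzygy i)).map
      (minimalCover (syzygy i)).isGr,
      inferInstanceAs (Module.Finite _ (LinearMap.ker (minimalCover (syzygy i)).map))⟩

variable [Module K M] [Module.Finite (MvPolynomial σ K) M]

/-- The minimal graded free resolution built from the chosen minimal covers. -/
noncomputable def minimalResolution (ℳ : ℤ → Submodule K M)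
    (hℳ : ∀ j x, x ∈ ℳ j ↔ M.proj j x = x) : MinimalGradedFreeResolution (σ := σ) ℳ :=
  let cov (i : ℕ) := minimalCover (M.syzygy i)
  let diff (i : ℕ) : (Fin (cov (i + 1)).rank → MvPolynomial σ K) →ₗ[MvPolynomial σ K]
      (Fin (cov i).rank → MvPolynomial σ K) :=
    (LinearMap.ker (cov i).map).subtype ∘ₗ (cov (i + 1)).map
  have hgr (i : ℕ) : IsGr (free (cov (i + 1)).deg) (free (cov i).deg) (diff i) := fun j v =>
    congrArg Subtype.val ((cov (i + 1)).isGr j v)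
  have hker (i : ℕ) : LinearMap.ker (diff i) = LinearMap.ker (cov (i + 1)).map :=
    LinearMap.ker_comp_of_ker_eq_bot _ (Submodule.ker_subtype _)
  have hrange (i : ℕ) : LinearMap.range (diff i) = LinearMap.ker (cov i).map :=
    (LinearMap.range_comp_of_range_eq_top _
      (LinearMap.range_eq_top.2 (cov (i + 1)).surjective)).trans (Submodule.range_subtype _)
  { rank := fun i => (cov i).rank
    deg := fun i => (cov i).deg
    aug := (cov 0).map
    diff := diff
    aug_mem := fun k => (hℳ _ _).2 ((isGr_free_iff _ _ _).1 (cov 0).isGr k)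
    diff_mem := fun i k l => mem_polyPiece_iff.2
      (congrFun ((isGr_free_iff _ (free (cov i).deg) (diff i)).1 (hgr i) k) l)
    aug_surjective := (cov 0).surjective
    exact_zero := fun y => SetLike.ext_iff.1 (hrange 0).symm y
    exact_succ := fun i y => SetLike.ext_iff.1 ((hker i).trans (hrange (i + 1)).symm) y
    minimal := fun i k l => (cov i).minimal _ ((cov (i + 1)).map (Pi.single k 1)).2 l }

end Resolution

section Bound

variable {M} [Module K M] {ℳ : ℤ → Submodule K M} (hℳ : ∀ j x, x ∈ ℳ j ↔ M.proj j x = x)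
  (F : MinimalGradedFreeResolution (σ := σ) ℳ)

include hℳ in
lemma isGr_aug : IsGr (free (F.deg 0)) M F.aug :=
  (isGr_free_iff _ _ _).2 fun k => (hℳ _ _).1 (F.aug_mem k)

lemma isGr_diff (i : ℕ) : IsGr (free (F.deg (i + 1))) (free (F.deg i)) (F.diff i) :=
  (isGr_free_iff _ (free (F.deg i)) _).2 fun k => funext fun l =>
    mem_polyPiece_iff.1 (F.diff_mem i k l)

lemma constantCoeff_diff (i : ℕ) (v : Fin (F.rank (i + 1)) → MvPolynomial σ K)
    (l : Fin (F.rank i)) : constantCoeff (F.diff i v l) = 0 := by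
  rw [LinearMap.pi_apply_eq_sum_univ (F.diff i) v, Finset.sum_apply, map_sum]
  refine Finset.sum_eq_zero fun k _ => ?_
  have := F.minimal i k l
  rw [Pi.smul_apply, smul_eq_mul, map_mul]
  have hk : (fun j => if k = j then (1 : MvPolynomial σ K) else 0) = Pi.single k 1 := by
    funext j
    simp [Pi.single_apply, eq_comm]
  rw [hk, this, mul_zero]

/-- The `i`-th syzygy module of a resolution. -/
noncomputable def resolutionKer : ∀ i : ℕ, Submodule (MvPolynomial σ K)
    (free (F.deg i) : GradedMod K σ)
  | 0 => LinearMap.ker F.aug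
  | i + 1 => LinearMap.ker (F.diff i)

include hℳ in
lemma proj_mem_resolutionKer (i : ℕ) (j : ℤ) (x : (free (F.deg i) : GradedMod K σ))
    (hx : x ∈ resolutionKer F i) :
    (free (F.deg i) : GradedMod K σ).proj j x ∈ resolutionKer F i := by
  cases i with
  | zero =>
    have hx : F.aug x = 0 := hx
    show F.aug _ = 0
    rw [isGr_aug hℳ F, hx, map_zero]
  | succ i =>
    have hx : F.diff i x = 0 := hx
    show F.diff i _ = 0
    rw [isGr_diff F, hx, map_zero]

/-- The syzygy modules as graded modules. -/
noncomputable abbrev resolutionSyzygy (i : ℕ) : GradedMod K σ :=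
  (free (F.deg i)).sub (resolutionKer F i) (proj_mem_resolutionKer hℳ F i)

lemma range_diff (i : ℕ) : LinearMap.range (F.diff i) = resolutionKer F i := by
  cases i with
  | zero => exact (LinearMap.exact_iff.1 F.exact_zero).symm
  | succ i => exact (LinearMap.exact_iff.1 (F.exact_succ i)).symm

/-- The cover of the `i`-th syzygy module. -/
noncomputable def syzygyCover (i : ℕ) : (Fin (F.rank (i + 1)) → MvPolynomial σ K)
    →ₗ[MvPolynomial σ K] resolutionSyzygy hℳ F i :=
  (F.diff i).codRestrict (resolutionKer F i) fun v => range_diff F i ▸ ⟨v, rfl⟩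

lemma isGr_syzygyCover (i : ℕ) :
    IsGr (free (F.deg (i + 1))) (resolutionSyzygy hℳ F i) (syzygyCover hℳ F i) :=
  fun j v => Subtype.ext (isGr_diff F i j v)

lemma syzygyCover_surjective (i : ℕ) : Function.Surjective (syzygyCover hℳ F i) := by
  rintro ⟨x, hx⟩
  have : x ∈ LinearMap.range (F.diff i) := (range_diff F i).symm ▸ hx
  obtain ⟨v, rfl⟩ := this
  exact ⟨v, rfl⟩

lemma ker_syzygyCover (i : ℕ) :
    LinearMap.ker (syzygyCover hℳ F i) = resolutionKer F (i + 1) :=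
  LinearMap.ker_codRestrict _ _ _

lemma regAt_ker_syzygyCover_iff (i k : ℕ) (c : ℤ) :
    RegAt k (ker (M := free (F.deg (i + 1))) (syzygyCover hℳ F i) (isGr_syzygyCover hℳ F i)) c ↔
      RegAt k (resolutionSyzygy hℳ F (i + 1)) c := by
  constructor
  · exact RegAt.of_equiv (LinearEquiv.ofEq _ _ (ker_syzygyCover hℳ F i)) fun j x => rfl
  · exact RegAt.of_equiv (LinearEquiv.ofEq _ _ (ker_syzygyCover hℳ F i).symm) fun j x => rfl

lemma constantCoeff_resolutionKer (i : ℕ) (v : Fin (F.rank i) → MvPolynomial σ K)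
    (hv : v ∈ resolutionKer F i) (l : Fin (F.rank i)) : constantCoeff (v l) = 0 := by
  rw [← range_diff] at hv
  obtain ⟨w, rfl⟩ := hv
  exact constantCoeff_diff F i w l

include hℳ in
/-- A minimal graded free resolution computes the regularity. -/
theorem regLE_iff_deg_le {c : ℤ} : RegLE M c ↔ ∀ i k, F.deg i k ≤ c + i := by
  constructor
  · intro h
    -- The two bounds feed each other: a bound on a syzygy module bounds its minimal generators, and
    -- these bound the next syzygy. The syzygy inside `F_i` is covered by `F_{i+1}`, hence the `+
    -- 1`.
    have key : ∀ i : ℕ, (∀ k, F.deg i k ≤ c + i) ∧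
        RegLE (resolutionSyzygy hℳ F i) (c + i + 1) := by
      intro i
      induction i with
      | zero =>
        have hdeg : ∀ k, F.deg 0 k ≤ c := RegAt.deg_le (isGr_aug hℳ F) F.aug_surjective
          (fun v hv => constantCoeff_resolutionKer F 0 v hv) (h 1)
        simp only [Nat.cast_zero, add_zero]
        exact ⟨hdeg, RegLE.firstSyzygy (isGr_aug hℳ F) F.aug_surjective hdeg h⟩
      | succ i ih =>
        have hdeg : ∀ k, F.deg (i + 1) k ≤ c + i + 1 := RegAt.deg_le (isGr_syzygyCover hℳ F i)
          (syzygyCover_surjective hℳ F i)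
          (fun v hv => constantCoeff_resolutionKer F (i + 1) v
            (by rw [← ker_syzygyCover hℳ F i]; exact hv)) (ih.2 1)
        rw [Nat.cast_succ, ← add_assoc]
        refine ⟨hdeg, fun k => (regAt_ker_syzygyCover_iff hℳ F i k _).1 ?_⟩
        exact RegLE.firstSyzygy (isGr_syzygyCover hℳ F i) (syzygyCover_surjective hℳ F i) hdeg ih.2 k
    exact fun i => (key i).1
  · intro h
    -- Conversely, the tails of `F` themselves witness the bounds.
    have key : ∀ k i : ℕ, RegAt k (resolutionSyzygy hℳ F i) (c + i + 1) := by
      intro k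
      induction k with
      | zero => intro i; trivial
      | succ k ih =>
        intro i
        refine ⟨_, _, F.deg (i + 1), syzygyCover hℳ F i, isGr_syzygyCover hℳ F i,
          fun l => ?_, syzygyCover_surjective hℳ F i, ?_⟩
        · simpa [add_assoc] using h (i + 1) l
        · refine (regAt_ker_syzygyCover_iff hℳ F i k _).2 ?_
          simpa [add_assoc] using ih (i + 1)
    intro k
    cases k with
    | zero => trivial
    | succ k =>
      refine ⟨_, _, F.deg 0, F.aug, isGr_aug hℳ F, fun l => by simpa using h 0 l,
        F.aug_surjective, ?_⟩
      have := key k 0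
      rwa [Nat.cast_zero, add_zero] at this

end Bound

end GradedMod

/-! ### Homogeneous ideals. -/

section HomogeneousIdeal

variable {K : Type*} [Field K] {σ : Type*}

/-- Ideals of the polynomial ring which contain the homogeneous components of their elements. -/
def IsHomogeneousIdeal (𝔞 : Ideal (MvPolynomial σ K)) : Prop :=
  ∀ (j : ℤ), ∀ x ∈ 𝔞, polyComp j x ∈ 𝔞

variable {𝔞 𝔟 : Ideal (MvPolynomial σ K)}

lemma IsHomogeneousIdeal.polyComp_mul_mem (h : IsHomogeneousIdeal 𝔞) (a : MvPolynomial σ K)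
    {x : MvPolynomial σ K} (hx : x ∈ 𝔞) (𝔠 : Ideal (MvPolynomial σ K))
    (hc : ∀ b, ∀ y ∈ 𝔞, polyComp b a * y ∈ 𝔠) (j : ℤ) : polyComp j (a * x) ∈ 𝔠 := by
  obtain ⟨s, -, hs⟩ := polyComp_exists_sum x
  rw [← hs, Finset.mul_sum, map_sum]
  refine Submodule.sum_mem _ fun i _ => ?_
  rw [polyComp_mul_of_mem (polyComp_mem i x)]
  exact hc _ _ (h i x hx)

lemma isHomogeneousIdeal_span {S : Set (MvPolynomial σ K)}
    (hS : ∀ x ∈ S, ∃ d, x ∈ polyPiece K σ d) : IsHomogeneousIdeal (Ideal.span S) := by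
  intro j x hx
  refine Submodule.span_induction (p := fun x _ => ∀ j, polyComp j x ∈ Ideal.span S) ?_ ?_ ?_ ?_
    hx j
  · intro x hx j
    obtain ⟨d, hd⟩ := hS x hx
    rw [polyComp_of_mem hd]
    split_ifs
    exacts [Ideal.subset_span hx, Ideal.zero_mem _]
  · intro j; rw [map_zero]; exact Ideal.zero_mem _
  · intro x y _ _ hx hy j; rw [map_add]; exact Ideal.add_mem _ (hx j) (hy j)
  · intro a x _ hx j
    obtain ⟨s, -, hs⟩ := polyComp_exists_sum x
    rw [← hs, smul_eq_mul, Finset.mul_sum, map_sum]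
    refine Submodule.sum_mem _ fun i _ => ?_
    rw [polyComp_mul_of_mem (polyComp_mem i x)]
    exact Ideal.mul_mem_left _ _ (hx i)

lemma IsHomogeneousIdeal.sup (ha : IsHomogeneousIdeal 𝔞) (hb : IsHomogeneousIdeal 𝔟) :
    IsHomogeneousIdeal (𝔞 ⊔ 𝔟) := by
  intro j x hx
  obtain ⟨y, hy, z, hz, rfl⟩ := Submodule.mem_sup.1 hx
  rw [map_add]
  exact Submodule.add_mem_sup (ha j y hy) (hb j z hz)

lemma IsHomogeneousIdeal.mul (ha : IsHomogeneousIdeal 𝔞) (hb : IsHomogeneousIdeal 𝔟) :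
    IsHomogeneousIdeal (𝔞 * 𝔟) := by
  intro j x hx
  refine Submodule.mul_induction_on hx (fun a hma b hmb => ?_) fun y z hy hz => ?_
  · exact hb.polyComp_mul_mem a hmb _ (fun i y hy => Ideal.mul_mem_mul (ha i a hma) hy) j
  · rw [map_add]; exact Ideal.add_mem _ hy hz

lemma IsHomogeneousIdeal.pow (ha : IsHomogeneousIdeal 𝔞) (s : ℕ) :
    IsHomogeneousIdeal (𝔞 ^ s) := by
  induction s with
  | zero => intro j x _; rw [pow_zero, Ideal.one_eq_top]; trivial
  | succ s ih => rw [pow_succ]; exact ih.mul ha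

lemma IsHomogeneousIdeal.colon (ha : IsHomogeneousIdeal 𝔞) {d : ℤ} {g : MvPolynomial σ K}
    (hg : g ∈ polyPiece K σ d) : IsHomogeneousIdeal (Submodule.colon 𝔞 {g}) := by
  intro j x hx
  rw [Submodule.mem_colon_singleton, smul_eq_mul] at hx ⊢
  have := ha (j + d) _ hx
  rwa [polyComp_mul_of_mem hg, add_sub_cancel_right] at this

end HomogeneousIdeal

/-! ### Graded quotients of the polynomial ring and exact values of the regularity. -/

namespace GradedMod

variable {K : Type u} [Field K] {σ : Type}

/-- The graded module `A/𝔞`. -/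
@[reducible]
noncomputable def quot (𝔞 : Ideal (MvPolynomial σ K)) (h : IsHomogeneousIdeal 𝔞) :
    GradedMod K σ where
  carrier := MvPolynomial σ K ⧸ 𝔞
  proj j := QuotientAddGroup.lift 𝔞.toAddSubgroup
    ((Ideal.Quotient.mk 𝔞).toAddMonoidHom.comp (polyComp j).toAddMonoidHom)
    fun x hx => Ideal.Quotient.eq_zero_iff_mem.2 (h j x hx)
  proj_self j x := by
    obtain ⟨x, rfl⟩ := Ideal.Quotient.mk_surjective x
    exact congrArg (Ideal.Quotient.mk 𝔞) (polyComp_self j x)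
  proj_smul a x d j hx := by
    obtain ⟨x, rfl⟩ := Ideal.Quotient.mk_surjective x
    rw [← hx]
    exact congrArg (Ideal.Quotient.mk 𝔞) (polyComp_mul_of_mem (polyComp_mem d x) j a)
  exists_sum x := by
    obtain ⟨x, rfl⟩ := Ideal.Quotient.mk_surjective x
    obtain ⟨s, h0, hs⟩ := polyComp_exists_sum x
    refine ⟨s, fun j hj => ?_, ?_⟩
    · exact (congrArg (Ideal.Quotient.mk 𝔞) (h0 j hj)).trans (map_zero _)
    · exact (map_sum (Ideal.Quotient.mk 𝔞) _ s).symm.trans (congrArg (Ideal.Quotient.mk 𝔞) hs)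

variable {𝔞 : Ideal (MvPolynomial σ K)} {h : IsHomogeneousIdeal 𝔞}

lemma quot_proj_mk (j : ℤ) (x : MvPolynomial σ K) :
    (quot 𝔞 h).proj j (Ideal.Quotient.mk 𝔞 x) = Ideal.Quotient.mk 𝔞 (polyComp j x) := rfl

lemma mem_quotientPiece_iff (j : ℤ) (x : MvPolynomial σ K ⧸ 𝔞) :
    x ∈ quotientPiece 𝔞 j ↔ (quot 𝔞 h).proj j x = x := by
  constructor
  · rintro ⟨y, hy, rfl⟩
    exact congrArg (Ideal.Quotient.mk 𝔞) (mem_polyPiece_iff.1 hy)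
  · intro hx
    obtain ⟨y, rfl⟩ := Ideal.Quotient.mk_surjective x
    exact ⟨polyComp j y, polyComp_mem j y, hx⟩

variable (h) in
-- Lower bounds for the supremum need a resolution to exist. Upper bounds hold for each resolution
-- separately, so uniqueness of Betti numbers is never invoked.
lemma exists_resolution_entry [Finite σ] {c : ℤ} (hc : ¬ RegLE (quot 𝔞 h) c) :
    ∃ x : ℤ, c < x ∧ ((x : ℝ) : EReal) ≤ quotientRegularity 𝔞 := by
  let F : MinimalGradedFreeResolution (σ := σ) (quotientPiece 𝔞) :=
    minimalResolution (quot 𝔞 h) (quotientPiece 𝔞) mem_quotientPiece_iff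
  rw [regLE_iff_deg_le (M := quot 𝔞 h) mem_quotientPiece_iff F] at hc
  push Not at hc
  obtain ⟨i, k, hik⟩ := hc
  refine ⟨F.deg i k - i, by omega, le_sSup ⟨F, i, F.deg i k, ?_, rfl⟩⟩
  exact Finset.card_ne_zero_of_mem (Finset.mem_filter.2 ⟨Finset.mem_univ k, rfl⟩)

variable (h) in
lemma quotientRegularity_le {c : ℤ} (hc : RegLE (quot 𝔞 h) c) :
    quotientRegularity 𝔞 ≤ ((c : ℝ) : EReal) := by
  refine sSup_le ?_
  rintro x ⟨F, i, j, hj, rfl⟩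
  obtain ⟨k, hk⟩ := Finset.card_ne_zero.1 hj
  have hk : F.deg i k = j := (Finset.mem_filter.1 hk).2
  have := (regLE_iff_deg_le (M := quot 𝔞 h) mem_quotientPiece_iff F).1 hc i k
  rw [EReal.coe_le_coe_iff, Int.cast_le]
  omega

variable (h) in
lemma regLE_of_quotientRegularity_lt [Finite σ] {c : ℤ}
    (hc : quotientRegularity 𝔞 < ((c : ℝ) : EReal)) : RegLE (quot 𝔞 h) (c - 1) := by
  by_contra hn
  obtain ⟨x, hx, hle⟩ := exists_resolution_entry h hn
  have := hle.trans_lt hc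
  rw [EReal.coe_lt_coe_iff, Int.cast_lt] at this
  omega

/-- The regularity of `M` is `a`. -/
def HasReg (M : GradedMod K σ) (a : ℤ) : Prop := ∀ c, RegLE M c ↔ a ≤ c

lemma hasReg_of {M : GradedMod K σ} {a : ℤ} (h1 : RegLE M a) (h2 : ¬ RegLE M (a - 1)) :
    HasReg M a := fun c => ⟨fun hc => by
      by_contra hlt
      exact h2 (hc.mono (by omega)), fun hc => h1.mono hc⟩

lemma HasReg.shift {M : GradedMod K σ} {a : ℤ} (h : HasReg M a) (d : ℤ) :
    HasReg (M.shift d) (a + d) := fun c => by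
  rw [regLE_shift_iff, h]; omega

variable (h) in
lemma quotientRegularity_eq [Finite σ] {a : ℤ} (ha : HasReg (quot 𝔞 h) a) :
    quotientRegularity 𝔞 = ((a : ℝ) : EReal) := by
  refine le_antisymm (quotientRegularity_le h ((ha a).2 le_rfl)) ?_
  obtain ⟨x, hx, hle⟩ := exists_resolution_entry h (c := a - 1) (by rw [ha]; omega)
  refine le_trans ?_ hle
  rw [EReal.coe_le_coe_iff, Int.cast_le]
  omega

section ShortExact

variable {N M P : GradedMod K σ} {a b : ℤ}
    {f : N →ₗ[MvPolynomial σ K] M} {g : M →ₗ[MvPolynomial σ K] P}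

/-- As `M` is strictly below `N`, the regularity of `N` can only come from `P`, one homological
degree higher. -/
lemma IsShortExact.hasReg_right (h : IsShortExact N M P f g) (hN : HasReg N a) (hM : HasReg M b)
    (hba : b < a) : HasReg P (a - 1) := by
  refine hasReg_of (h.regLE_right ((hM _).2 (by omega)) ((hN _).2 (by omega))) fun hP => ?_
  have := (hN _).1 (h.regLE_left (c := a - 1) ((hM _).2 (by omega)) hP)
  omega

/-- If `N` were bounded by `b - 1`, then so would be its extension `M`. -/
lemma IsShortExact.hasReg_left (h : IsShortExact N M P f g) (hM : HasReg M b)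
    (hP : RegLE P (b - 1)) : HasReg N b := by
  refine hasReg_of (h.regLE_left ((hM _).2 le_rfl) hP) fun hN => ?_
  have := (hM _).1 (h.regLE_middle hN hP)
  omega

/-- A bound `a - 1` on `M`, with `N` bounded by `a`, would pass to `P`. -/
lemma IsShortExact.hasReg_middle (h : IsShortExact N M P f g) (hN : RegLE N a)
    (hP : HasReg P a) : HasReg M a := by
  refine hasReg_of (h.regLE_middle hN ((hP _).2 le_rfl)) fun hM => ?_
  have := (hP _).1 (h.regLE_right hM (by rwa [sub_add_cancel]))
  omega

end ShortExact

/-- The exact sequence `0 → (A/(𝔟 : g))(-d) → A/𝔟 → A/(𝔟 + (g)) → 0`. -/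
lemma exists_isShortExact_quot {𝔟 𝔠 𝔡 : Ideal (MvPolynomial σ K)} (hb : IsHomogeneousIdeal 𝔟)
    (hc : IsHomogeneousIdeal 𝔠) (hd : IsHomogeneousIdeal 𝔡) {d : ℤ} {g : MvPolynomial σ K}
    (hg : g ∈ polyPiece K σ d) (hcol : ∀ x, x ∈ 𝔠 ↔ x * g ∈ 𝔟) (hsup : 𝔡 = 𝔟 ⊔ Ideal.span {g}) :
    ∃ (f : (quot 𝔠 hc).shift d →ₗ[MvPolynomial σ K] quot 𝔟 hb)
      (p : quot 𝔟 hb →ₗ[MvPolynomial σ K] quot 𝔡 hd),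
      IsShortExact ((quot 𝔠 hc).shift d) (quot 𝔟 hb) (quot 𝔡 hd) f p := by
  refine ⟨Submodule.mapQ 𝔠 𝔟 (LinearMap.toSpanSingleton _ _ g) fun x hx => (hcol x).1 hx,
    Submodule.factor (hsup ▸ le_sup_left), ?_, ?_, ?_, ?_, ?_⟩
  · intro j x
    obtain ⟨x, rfl⟩ := Ideal.Quotient.mk_surjective x
    exact congrArg (Ideal.Quotient.mk 𝔟) (polyComp_mul_of_mem hg j x).symm
  · intro j x
    obtain ⟨x, rfl⟩ := Ideal.Quotient.mk_surjective x
    rfl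
  · rw [injective_iff_map_eq_zero]
    intro x hx
    obtain ⟨x, rfl⟩ := Ideal.Quotient.mk_surjective x
    exact Ideal.Quotient.eq_zero_iff_mem.2 ((hcol x).2 (Ideal.Quotient.eq_zero_iff_mem.1 hx))
  · exact Submodule.factor_surjective _
  · intro y
    obtain ⟨y, rfl⟩ := Ideal.Quotient.mk_surjective y
    constructor
    · intro hy
      have hy : y ∈ 𝔡 := Ideal.Quotient.eq_zero_iff_mem.1 hy
      rw [hsup, Submodule.mem_sup] at hy
      obtain ⟨b, hb, z, hz, rfl⟩ := hy
      obtain ⟨a, rfl⟩ := Ideal.mem_span_singleton'.1 hz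
      refine ⟨Ideal.Quotient.mk 𝔠 a, ?_⟩
      refine (Ideal.Quotient.eq).2 ?_
      have : a * g - (b + a * g) = -b := by ring
      show a * g - (b + a * g) ∈ 𝔟
      rw [this]
      exact neg_mem hb
    · rintro ⟨x, hx⟩
      obtain ⟨x, rfl⟩ := Ideal.Quotient.mk_surjective x
      rw [← hx]
      refine Ideal.Quotient.eq_zero_iff_mem.2 ?_
      rw [hsup]
      exact Submodule.mem_sup_right (Ideal.mul_mem_left _ _ (Ideal.mem_span_singleton_self g))

/-- All generators would lie in negative degrees, where the quotient vanishes. -/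
lemma eq_top_of_regLE_neg (h : IsHomogeneousIdeal 𝔞) {c : ℤ} (hc : c < 0)
    (hreg : RegLE (quot 𝔞 h) c) : 𝔞 = ⊤ := by
  classical
  obtain ⟨ι, _, deg, φ, hφ, hdeg, hs, -⟩ := hreg 1
  have hzero : φ = 0 := by
    rw [eq_linearCombination φ]
    refine LinearMap.ext fun v => ?_
    rw [Fintype.linearCombination_apply]
    refine Finset.sum_eq_zero fun i _ => ?_
    rw [← (isGr_free_iff deg _ φ).1 hφ]
    obtain ⟨y, hy⟩ := Ideal.Quotient.mk_surjective (φ (Pi.single i 1))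
    rw [← hy, quot_proj_mk, polyPiece_eq_zero_of_neg (polyComp_mem _ y)
      ((hdeg i).trans_lt hc), map_zero, smul_zero]
  obtain ⟨v, hv⟩ := hs (Ideal.Quotient.mk 𝔞 1)
  rw [hzero] at hv
  exact (Ideal.eq_top_iff_one _).2 (Ideal.Quotient.eq_zero_iff_mem.1 hv.symm)

lemma hasReg_quot_bot (h : IsHomogeneousIdeal (⊥ : Ideal (MvPolynomial σ K))) :
    HasReg (quot ⊥ h) 0 := by
  refine hasReg_of (fun k => ?_) fun hr => bot_ne_top (eq_top_of_regLE_neg h (by omega) hr)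
  refine RegAt.of_equiv (M := free fun _ : Unit => (0 : ℤ))
    ((LinearEquiv.funUnique Unit (MvPolynomial σ K) (MvPolynomial σ K)).trans
      (Submodule.quotEquivOfEqBot ⊥ rfl).symm) ?_ (regAt_free _ (fun _ => le_rfl) k)
  intro j v
  have : (free fun _ : Unit => (0 : ℤ) : GradedMod K σ).proj j v default =
      polyComp j (v default) := by
    rw [free_proj_apply, sub_zero]
  exact congrArg (Ideal.Quotient.mk ⊥) this

end GradedMod

/-! ### Colon ideals and powers for `d`-sequences. -/

section DSequence

variable {R : Type*} [CommRing R] {n : ℕ} (f : Fin n → R)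

lemma Ideal.mem_left_of_mem_mul {J L : Ideal R} {x : R} (hx : x ∈ J * L) : x ∈ J :=
  (Ideal.mul_le_left : J * L ≤ J) hx

lemma initialIdeal_zero : initialIdeal f 0 = ⊥ := by
  simp [initialIdeal]

lemma initialIdeal_succ {i : ℕ} (hi : i < n) :
    initialIdeal f (i + 1) = initialIdeal f i ⊔ Ideal.span {f ⟨i, hi⟩} := by
  rw [initialIdeal, initialIdeal, ← Ideal.span_union, ← Set.image_singleton, ← Set.image_union]
  congr 2
  ext j
  simp only [Set.mem_ofPred_eq, Set.mem_union, Set.mem_singleton_iff, Fin.ext_iff]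
  omega

lemma initialIdeal_top : initialIdeal f n = Ideal.span (Set.range f) := by
  rw [initialIdeal, ← Set.image_univ]
  congr 2
  ext j
  simp

lemma initialIdeal_le_span (i : ℕ) : initialIdeal f i ≤ Ideal.span (Set.range f) :=
  Ideal.span_mono (Set.image_subset_range _ _)

lemma mem_span_range (i : Fin n) : f i ∈ Ideal.span (Set.range f) :=
  Ideal.subset_span ⟨i, rfl⟩

variable {f}

lemma IsDSequence.mem_initialIdeal (h : IsDSequence f) (i : Fin n) {x : R}
    (hx : x * f i ∈ initialIdeal f i) (hxI : x ∈ Ideal.span (Set.range f)) :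
    x ∈ initialIdeal f i := by
  rw [← h i]
  exact ⟨Submodule.mem_colon_singleton.2 hx, hxI⟩

lemma mem_initialIdeal_succ_mul {i : ℕ} (hi : i < n) {L : Ideal R} {x : R}
    (hx : x ∈ initialIdeal f (i + 1) * L) :
    ∃ a ∈ initialIdeal f i * L, ∃ b ∈ L, a + b * f ⟨i, hi⟩ = x := by
  rw [initialIdeal_succ f hi, Ideal.sup_mul] at hx
  obtain ⟨a, ha, z, hz, rfl⟩ := Submodule.mem_sup.1 hx
  obtain ⟨b, hb, rfl⟩ := Ideal.mem_span_singleton_mul.1 hz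
  exact ⟨a, ha, b, hb, by rw [mul_comm b]⟩

/-- For a `d`-sequence `f` generating `I`, one has
`⟨f_1, …, f_i⟩ ∩ I^(s+1) = ⟨f_1, …, f_i⟩ I^s`. -/
lemma IsDSequence.inf_pow_le (h : IsDSequence f) (s : ℕ) {i : ℕ} (hi : i ≤ n) :
    initialIdeal f i ⊓ Ideal.span (Set.range f) ^ (s + 1) ≤
      initialIdeal f i * Ideal.span (Set.range f) ^ s := by
  set I := Ideal.span (Set.range f) with hI
  induction s generalizing i with
  | zero => rw [pow_zero, mul_one]; exact inf_le_left
  | succ s ihs =>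
    induction hi using Nat.decreasingInduction with
    | self => rw [initialIdeal_top, ← hI, ← pow_succ']; exact inf_le_right
    | of_succ i hi ih =>
      intro x hx
      have hle : initialIdeal f i ≤ initialIdeal f (i + 1) := by
        rw [initialIdeal_succ f hi]; exact le_sup_left
      -- In `x = a + b f_{i+1}` the `d`-sequence property puts `b` into `J_i`, so the induction on
      -- the exponent applies to `b`.
      obtain ⟨a, ha, b, hb, rfl⟩ := mem_initialIdeal_succ_mul hi (ih ⟨hle hx.1, hx.2⟩)
      have hbf : b * f ⟨i, hi⟩ ∈ initialIdeal f i :=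
        ((initialIdeal f i).add_mem_iff_right (Ideal.mem_left_of_mem_mul ha)).1 hx.1
      have hbJ := h.mem_initialIdeal ⟨i, hi⟩ hbf (Ideal.pow_le_self s.succ_ne_zero hb)
      have := ihs hi.le ⟨hbJ, hb⟩
      refine Ideal.add_mem _ ha ?_
      rw [pow_succ, ← mul_assoc]
      exact Ideal.mul_mem_mul this (mem_span_range f _)

/-- If `x f_{i+1} = y + z` with `y ∈ J_i` and `z ∈ I^{s+1}`, then `z ∈ J_{i+1} ∩ I^{s+1} = J_{i+1}
I^s`. So `z` is `b f_{i+1}` modulo `J_i` with `b ∈ I^s`, and cancelling `f_{i+1}` gives `x - b ∈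
J_i`. -/
lemma IsDSequence.mem_sup_pow_iff (h : IsDSequence f) (s : ℕ) {i : ℕ} (hi : i < n)
    (hreg : ∀ x, x * f ⟨i, hi⟩ ∈ initialIdeal f i → x ∈ initialIdeal f i) (x : R) :
    x ∈ initialIdeal f i ⊔ Ideal.span (Set.range f) ^ s ↔
      x * f ⟨i, hi⟩ ∈ initialIdeal f i ⊔ Ideal.span (Set.range f) ^ (s + 1) := by
  constructor
  · intro hx
    obtain ⟨a, ha, b, hb, rfl⟩ := Submodule.mem_sup.1 hx
    rw [add_mul, pow_succ]
    exact Submodule.add_mem_sup (Ideal.mul_mem_right _ _ ha)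
      (Ideal.mul_mem_mul hb (mem_span_range f _))
  · intro hx
    obtain ⟨y, hy, z, hz, hyz⟩ := Submodule.mem_sup.1 hx
    have hzJ : z ∈ initialIdeal f (i + 1) := by
      rw [eq_sub_of_add_eq' hyz, initialIdeal_succ f hi]
      exact Ideal.sub_mem _ (Submodule.mem_sup_right
        (Ideal.mul_mem_left _ _ (Ideal.mem_span_singleton_self _))) (Submodule.mem_sup_left hy)
    obtain ⟨a, ha, b, hb, rfl⟩ := mem_initialIdeal_succ_mul hi (h.inf_pow_le s hi ⟨hzJ, hz⟩)
    have : x - b ∈ initialIdeal f i := hreg _ (by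
      rw [sub_mul, ← hyz, ← add_assoc, add_sub_cancel_right]
      exact Ideal.add_mem _ hy (Ideal.mem_left_of_mem_mul ha))
    rw [← sub_add_cancel x b]
    exact Submodule.add_mem_sup this hb

/-- After multiplication by a positive power of `f_i` the element lies in `I`, where the
`d`-sequence property cancels one further factor. -/
lemma IsDSequence.mem_colon_pow (h : IsDSequence f) (i : Fin n) (s : ℕ) {x : R} :
    x * f i ∈ initialIdeal f i ↔ x * f i ^ (s + 1) ∈ initialIdeal f i := by
  induction s with
  | zero => rw [zero_add, pow_one]
  | succ s ih =>
    rw [ih]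
    constructor
    · intro hx
      rw [pow_succ, ← mul_assoc]
      exact Ideal.mul_mem_right _ _ hx
    · intro hx
      refine h.mem_initialIdeal i ?_ ?_
      · rwa [mul_assoc, ← pow_succ]
      · exact Ideal.mul_mem_left _ _ (Ideal.pow_mem_of_mem _ (mem_span_range f i) _ s.succ_pos)

lemma sup_span_pow_eq (J : Ideal R) (a : R) (s : ℕ) :
    J ⊔ (J ⊔ Ideal.span {a}) ^ s = J ⊔ Ideal.span {a ^ s} := by
  apply le_antisymm
  · refine sup_le le_sup_left ?_
    induction s with
    | zero => simp
    | succ s ih =>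
      rw [pow_succ]
      refine (Ideal.mul_mono ih le_rfl).trans ?_
      rw [Ideal.sup_mul, Ideal.mul_sup (Ideal.span {a ^ s}), Ideal.span_singleton_mul_span_singleton,
        ← pow_succ]
      have h1 : J * (J ⊔ Ideal.span {a}) ≤ J := Ideal.mul_le_left
      have h2 : Ideal.span {a ^ s} * J ≤ J := Ideal.mul_le_right
      exact sup_le (h1.trans le_sup_left) (sup_le_sup_right h2 _)
  · refine sup_le_sup_left ?_ _
    rw [← Ideal.span_singleton_pow]
    exact Ideal.pow_right_mono le_sup_right s

lemma mem_initialIdeal_of_isWeaklyRegular {r : ℕ} {f : Fin (r + 1) → R}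
    (h : RingTheory.Sequence.IsWeaklyRegular R (List.ofFn fun l : Fin r => f l.castSucc))
    {i : ℕ} (hi : i < r) {x : R} (hx : x * f ⟨i, hi.trans r.lt_succ_self⟩ ∈ initialIdeal f i) :
    x ∈ initialIdeal f i := by
  have hlen : i < (List.ofFn fun l : Fin r => f l.castSucc).length := by simpa using hi
  have h1 := h.regular_mod_prev i hlen
  rw [isSMulRegular_quotient_iff_mem_of_smul_mem] at h1
  have hJ : (Ideal.ofList ((List.ofFn fun l : Fin r => f l.castSucc).take i) • ⊤ :
      Submodule R R) = initialIdeal f i := by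
    rw [smul_eq_mul, Ideal.mul_top, Ideal.ofList, initialIdeal]
    congr 1
    ext y
    simp only [Set.mem_ofPred_eq, List.mem_take_iff_getElem, List.getElem_ofFn, List.length_ofFn,
      Set.mem_image]
    constructor
    · rintro ⟨j, hj, rfl⟩
      exact ⟨_, (lt_min_iff.1 hj).1, rfl⟩
    · rintro ⟨j, hj, rfl⟩
      exact ⟨j, lt_min hj (hj.trans hi), rfl⟩
  rw [hJ] at h1
  refine h1 x ?_
  rw [List.getElem_ofFn, smul_eq_mul, mul_comm]
  exact hx

end DSequence

/-! ### Regularity of complete intersections and the main theorem. -/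

section Main

open GradedMod

variable {K : Type u} [Field K] {σ : Type}

lemma isHomogeneousIdeal_initialIdeal {n : ℕ} {f : Fin n → MvPolynomial σ K} {d : Fin n → ℕ}
    (hd : ∀ l, (f l).IsHomogeneous (d l)) (i : ℕ) : IsHomogeneousIdeal (initialIdeal f i) :=
  isHomogeneousIdeal_span fun x hx => by
    obtain ⟨j, -, rfl⟩ := hx
    exact ⟨_, IsHomogeneous.mem_polyPiece (hd j)⟩

lemma pos_degree_of_ne_zero {I : Ideal (MvPolynomial σ K)} (hI : I ≠ ⊤) {a : MvPolynomial σ K}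
    (ha : a ∈ I) (ha0 : a ≠ 0) {d : ℕ} (hd : a.IsHomogeneous d) : 0 < d := by
  rw [Nat.pos_iff_ne_zero]
  rintro rfl
  have hC := eq_C_of_mem_polyPiece_zero (IsHomogeneous.mem_polyPiece hd)
  have hne : constantCoeff a ≠ 0 := fun h => ha0 (by rw [hC, h, C_0])
  refine hI (Ideal.eq_top_of_isUnit_mem I ha ?_)
  rw [hC]
  exact (IsUnit.mk0 _ hne).map C

/-- The regularity of `A/(f_1, …, f_i)` for a regular sequence. -/
lemma hasReg_initialIdeal {n : ℕ} {f : Fin n → MvPolynomial σ K} {d : Fin n → ℕ}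
    (hd : ∀ l, (f l).IsHomogeneous (d l)) (hpos : ∀ l, 0 < d l) {e : ℕ → ℤ}
    (he : ∀ l : Fin n, e l = d l) {r : ℕ} (hr : r ≤ n)
    (hreg : ∀ i (hi : i < r) x, x * f ⟨i, hi.trans_le hr⟩ ∈ initialIdeal f i →
      x ∈ initialIdeal f i) {i : ℕ} (hi : i ≤ r) :
    HasReg (quot (initialIdeal f i) (isHomogeneousIdeal_initialIdeal hd i))
      (∑ l ∈ Finset.range i, (e l - 1)) := by
  induction i with
  | zero =>
    have := hasReg_quot_bot (K := K) (σ := σ)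
      (initialIdeal_zero f ▸ isHomogeneousIdeal_initialIdeal hd 0)
    convert this using 2
    · exact initialIdeal_zero f
    · exact Finset.sum_range_zero _
  | succ i ih =>
    have hin : i < n := by omega
    obtain ⟨g, p, hgp⟩ := exists_isShortExact_quot (isHomogeneousIdeal_initialIdeal hd i)
      (isHomogeneousIdeal_initialIdeal hd i) (isHomogeneousIdeal_initialIdeal hd (i + 1))
      (IsHomogeneous.mem_polyPiece (hd ⟨i, hin⟩))
      (fun x => ⟨fun hx => Ideal.mul_mem_right _ _ hx, hreg i hi x⟩) (initialIdeal_succ f hin)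
    have h := ih (by omega)
    -- Positivity of the degree makes the shifted left term strictly larger; each generator adds its
    -- degree minus one.
    have := hgp.hasReg_right (h.shift _) h (by have := hpos ⟨i, hin⟩; omega)
    rw [Finset.sum_range_succ, he ⟨i, hin⟩]
    convert this using 1
    ring

end Main

open GradedMod in
theorem theorem2p4 {K : Type*} [Field K] [Infinite K] {m : ℕ}
    -- `n = r + 1` generators `f_1, …, f_n` of degrees `d_1, …, d_n`
    (r : ℕ) (f : Fin (r + 1) → MvPolynomial (Fin m) K) (d : Fin (r + 1) → ℕ)
    (hd : ∀ l, (f l).IsHomogeneous (d l))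
    (I : Ideal (MvPolynomial (Fin m) K)) (hI : I = Ideal.span (Set.range f))
    (haci : IsAlmostCompleteIntersection I)
    (hdseq : IsDSequence f)
    (hreg : RingTheory.Sequence.IsRegular (MvPolynomial (Fin m) K)
      (List.ofFn fun l : Fin r => f l.castSucc))
    (hlt : quotientRegularity I <
      (((∑ l : Fin r, (d l.castSucc : ℝ)) - ((r + 1 : ℕ) : ℝ) + 1 : ℝ) : EReal))
    (hmax : ∀ l, d l ≤ d (Fin.last r))
    (s : ℕ) (hs : 2 ≤ s) (i : ℕ) (hi : i ≤ r) :
    quotientRegularity (initialIdeal f i + I ^ s) =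
      (((∑ l : Fin (r + 1), (d l : ℝ)) - ((r + 1 : ℕ) : ℝ)
        + ((s : ℝ) - 2) * (d (Fin.last r) : ℝ) : ℝ) : EReal) := by
  -- The unit ideal has infinite height, and the zero ideal has no generators, so neither satisfies
  -- the generator count.
  have hItop : I ≠ ⊤ := by
    rintro rfl
    have := haci.1
    rw [Ideal.height_top, top_add] at this
    exact ENat.natCast_ne_top _ this
  have hIbot : I ≠ ⊥ := by
    rintro rfl
    have := haci.1
    rw [Submodule.spanFinrank_bot, Nat.cast_zero, eq_comm, add_eq_zero] at this
    exact one_ne_zero this.2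
  subst hI
  have hnzd : ∀ i (hi : i < r) x, x * f ⟨i, hi.trans_le r.le_succ⟩ ∈ initialIdeal f i →
      x ∈ initialIdeal f i := fun i hi x hx =>
    mem_initialIdeal_of_isWeaklyRegular hreg.toIsWeaklyRegular hi hx
  -- `f_n` is not yet known to be nonzero; positivity comes from some nonzero generator and the
  -- maximality of `d_n`.
  have hlast : 0 < d (Fin.last r) := by
    obtain ⟨l, hl⟩ : ∃ l, f l ≠ 0 := by
      by_contra! h0
      exact hIbot (Ideal.span_eq_bot.2 (by rintro _ ⟨l, rfl⟩; exact h0 l))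
    exact (pos_degree_of_ne_zero hItop (mem_span_range f l) hl (hd l)).trans_le (hmax l)
  have hpos : ∀ l, 0 < d l := by
    refine Fin.lastCases hlast fun l => ?_
    refine pos_degree_of_ne_zero hItop (mem_span_range f _) (fun h0 => hItop ?_) (hd l.castSucc)
    -- A zero term cannot be a nonzerodivisor modulo its predecessors unless these generate the unit
    -- ideal.
    refine (Ideal.eq_top_iff_one _).2 (initialIdeal_le_span f l (hnzd l l.2 1 ?_))
    have : f ⟨l, l.2.trans_le r.le_succ⟩ = 0 := h0
    rw [this, mul_zero]
    exact Ideal.zero_mem _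
  set I := Ideal.span (Set.range f) with hI
  let e : ℕ → ℤ := fun l => if h : l < r + 1 then d ⟨l, h⟩ else 0
  have he : ∀ l : Fin (r + 1), e l = d l := fun l => dif_pos l.2
  let ρ : ℤ := ∑ l ∈ Finset.range r, (e l - 1)
  let D : ℤ := d (Fin.last r)
  have hD : 1 ≤ D := Int.ofNat_le.2 hlast
  have hJhom := isHomogeneousIdeal_initialIdeal hd
  have hIhom : IsHomogeneousIdeal I := by
    rw [hI, ← initialIdeal_top]; exact hJhom (r + 1)
  have hfr : f (Fin.last r) ∈ polyPiece K (Fin m) D := IsHomogeneous.mem_polyPiece (hd _)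
  have hρ : (ρ : ℝ) = ∑ l : Fin r, (d l.castSucc : ℝ) - r := by
    have : ρ = ∑ l : Fin r, ((d l.castSucc : ℤ) - 1) := by
      refine (Fin.sum_univ_eq_sum_range (fun l => e l - 1) r).symm.trans ?_
      exact Finset.sum_congr rfl fun l _ => by rw [← he]; rfl
    rw [this]
    simp
  have hJreg : HasReg (quot (initialIdeal f r) (hJhom r)) ρ :=
    hasReg_initialIdeal hd hpos he r.le_succ hnzd le_rfl
  -- The bound in the hypothesis is exactly `ρ`, and a strict inequality of integers gains one.
  have hIreg : RegLE (quot I hIhom) (ρ - 1) := by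
    refine regLE_of_quotientRegularity_lt hIhom (hlt.trans_eq ?_)
    rw [EReal.coe_eq_coe_iff, hρ]
    push_cast
    ring
  have hIsup : I = initialIdeal f r ⊔ Ideal.span {f (Fin.last r)} := by
    rw [hI, ← initialIdeal_top, initialIdeal_succ f r.lt_succ_self]; rfl
  -- the regularity of `A/(J : f_n)`, where `J = (f_1, …, f_{n-1})`
  have hQhom := (hJhom r).colon hfr
  have hQreg : HasReg (quot _ hQhom) (ρ - D) := by
    obtain ⟨g, p, hgp⟩ := exists_isShortExact_quot (hJhom r) hQhom hIhom hfr
      (fun x => Submodule.mem_colon_singleton) hIsup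
    intro c
    have := hgp.hasReg_left hJreg hIreg (c + D)
    rw [regLE_shift_iff, add_sub_cancel_right] at this
    rw [this]; omega
  have hhom : ∀ i s, IsHomogeneousIdeal (initialIdeal f i ⊔ I ^ s) := fun i s =>
    (hJhom i).sup (hIhom.pow s)
  -- the case of all but the last generator
  have hlastreg : ∀ s : ℕ, HasReg (quot _ (hhom r (s + 2))) (ρ + (s + 1) * D - 1) := by
    intro s
    have hpow : f (Fin.last r) ^ (s + 2) ∈ polyPiece K (Fin m) ((s + 2 : ℕ) * D) := by
      have := IsHomogeneous.mem_polyPiece ((hd (Fin.last r)).pow (s + 2))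
      rw [Nat.cast_mul, mul_comm] at this
      exact this
    obtain ⟨g, p, hgp⟩ := exists_isShortExact_quot (hJhom r) hQhom (hhom r (s + 2)) hpow
      (fun x => Submodule.mem_colon_singleton.trans (hdseq.mem_colon_pow (Fin.last r) (s + 1)))
      (by rw [hIsup, sup_span_pow_eq])
    -- The required strict inequality is `ρ < ρ - D + (s + 2) D`, which holds as `D ≥ 1`.
    have := hgp.hasReg_right (hQreg.shift _) hJreg (by push_cast; nlinarith)
    convert this using 1
    push_cast
    ring
  -- Here `s` is the exponent minus two. The outer induction is on the exponent, the inner one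
  -- descends from `i = r`.
  have hmain : ∀ (s i : ℕ), i ≤ r → HasReg (quot _ (hhom i (s + 2))) (ρ + (s + 1) * D - 1) := by
    intro s
    induction s with
    | zero =>
      intro i hi
      induction hi using Nat.decreasingInduction with
      | self => exact hlastreg 0
      | of_succ i hi ih =>
        have hi' : i < r + 1 := by omega
        -- For exponent two the colon ideal is `J_i + I = I`, so the numerical hypothesis bounds the
        -- left term.
        obtain ⟨g, p, hgp⟩ := exists_isShortExact_quot (hhom i 2) hIhom (hhom (i + 1) 2)
          (IsHomogeneous.mem_polyPiece (hd ⟨i, hi'⟩))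
          (fun x => by
            have := hdseq.mem_sup_pow_iff 1 hi' (hnzd i hi) x
            rwa [pow_one, sup_eq_right.2 (initialIdeal_le_span f i)] at this)
          (by rw [initialIdeal_succ f hi', sup_right_comm])
        refine hgp.hasReg_middle ?_ ih
        rw [regLE_shift_iff]
        refine hIreg.mono ?_
        have : (d ⟨i, hi'⟩ : ℤ) ≤ D := Int.ofNat_le.2 (hmax _)
        push_cast
        linarith
    | succ s ihs =>
      intro i hi
      induction hi using Nat.decreasingInduction with
      | self => exact hlastreg (s + 1)
      | of_succ i hi ih =>
        have hi' : i < r + 1 := by omega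
        obtain ⟨g, p, hgp⟩ := exists_isShortExact_quot (hhom i (s + 1 + 2)) (hhom i (s + 2))
          (hhom (i + 1) (s + 1 + 2)) (IsHomogeneous.mem_polyPiece (hd ⟨i, hi'⟩))
          (hdseq.mem_sup_pow_iff (s + 2) hi' (hnzd i hi))
          (by rw [initialIdeal_succ f hi', sup_right_comm])
        refine hgp.hasReg_middle ?_ ih
        rw [regLE_shift_iff]
        -- The left term is `A/(J_i + I^{s+2})`, known from the previous exponent; its shift by
        -- `d_{i+1} ≤ D` stays within the target value.
        refine ((ihs i hi.le) _).2 ?_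
        have : (d ⟨i, hi'⟩ : ℤ) ≤ D := Int.ofNat_le.2 (hmax _)
        push_cast
        linarith
  obtain ⟨s, rfl⟩ := Nat.exists_eq_add_of_le' hs
  refine (quotientRegularity_eq (hhom i (s + 2)) (hmain s i hi)).trans ?_
  rw [EReal.coe_eq_coe_iff, Fin.sum_univ_castSucc]
  push_cast
  rw [hρ]
  simp only [D, Int.cast_natCast]
  ring
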